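/- Theorem. Notation. For $K\subseteq\mathbb N$ let $\delta_+(K)=\limsup_{n\to\infty}\frac{|K\cap\{1,\dots,n\}|}{n}$. For a real sequence $(y_n)_{n\ge1}$, $L\in\mathbb R$ and $A\subseteq\mathbb R$ define the indices of convergence \[ i(y_n;L)=1-\sup_{\varepsilon>0}\delta_+\big(\{n: y_n\notin\,]L-\varepsilon,L+\varepsilon[\,\}\big),\qquad i(y_n;A)=1-\sup_{\varepsilon>0}\delta_+\big(\{n: y_n\notin A+\,]-\varepsilon,\varepsilon[\,\}\big). \] For $f:[-1,1]\to\mathbb R$ let \[ L_nf(x)=\sum_{k=1}^n\ell_{n,k}(x)f(x_{n,k}),\qquad x_{n,k}=\cos\frac{(k-1)\pi}{n-1},\qquad \ell_{n,k}(x)=\prod_{j\ne k}\frac{x-x_{n,j}}{x_{n,k}-x_{n,j}} \] be the Lagrange interpolation operators at the Chebyshev nodes of the second kind. For $x_0\in\,]-1,1[$ and $d\in\mathbb R$ let $h_{x_0,d}$ be the function on $[-1,1]$ equal to $0$ for $x<x_0$, to $d$ for $x=x_0$ and to $1$ for $x>x_0$; let $H$ be the linear span of all $h_{x_0,d}$.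 Let $\mathcal C$ be the set of all continuous $F:[-1,1]\to\mathbb R$ which are monotone (increasing or decreasing) on $[-1,1]$ or satisfy the Dini–Lipschitz condition $\omega(F,\delta)=o(|\log\delta|^{-1})$ as $\delta\to0^+$, $\omega$ being the modulus of continuity. Finally let \[ g(x)=\frac{\sin(\pi x)}{\pi}\sum_{n=0}^{\infty}\frac{(-1)^n}{n+x},\qquad x\in\,]0,1[. \] Statement. Let $f\in\mathcal C+H=\{F+h: F\in\mathcal C,\ h\in H\}$ and let $x_1,\dots,x_N\in\,]-1,1[$ be the (finitely many, distinct) points of discontinuity of $f$; at each of them the finite one-sided limits $f(x_i-0)$, $f(x_i+0)$ exist. Let $\theta_i\in\,]0,\pi[$ with $x_i=\cos\theta_i$, let $d_i=f(x_i)$, and let \[ g_i(x)=f(x_i-0)+\big(f(x_i+0)-f(x_i-0)\big)g(x),\qquad x\in\,]0,1[. \] Then $(L_nf)_{n\ge1}$ converges to $f$ uniformly on every compact subset of $]-1,1[\,\setminus\{x_1,\dots,x_N\}$. Moreover, for every $i$ such that $x_i$ is a jump, i.e. $f(x_i-0)\neq f(x_i+0)$: (i) Suppose $\theta_i/\pi=p/q$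 with $p,q\in\mathbb N$, $q\ne0$, $\gcd(p,q)=1$. If $d_i\ne g_i(m/q)$ for all $m=1,\dots,q-1$, then \[ i(L_nf(x_i);d_i)=\frac1q,\qquad i\big(L_nf(x_i);g_i(m/q)\big)=\frac1q\quad(m=1,\dots,q-1). \] If $g_i(m_0/q)=d_i$ for some $m_0\in\{1,\dots,q-1\}$, then \[ i(L_nf(x_i);d_i)=\frac2q,\qquad i\big(L_nf(x_i);g_i(m/q)\big)=\frac1q\quad(m=1,\dots,q-1,\ m\neq m_0). \] (ii) Suppose $\theta_i/\pi$ is irrational and $A\subset\mathbb R$ is a (bounded) Peano–Jordan measurable set. Then $g_i^{-1}(A)\subseteq\,]0,1[$ is Peano–Jordan measurable and \[ i(L_nf(x_i);A)=|g_i^{-1}(A)|, \] where $|\cdot|$ denotes the Peano–Jordan measure. -/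

import Mathlib

open Filter Topology Set MeasureTheory
open scoped Pointwise

noncomputable section

/-! ### Densities and the index of convergence of a real sequence -/

/-- Upper density of `K ⊆ ℕ`: the limsup of `|K ∩ {1, …, n}| / n`. -/
def upperDensity (K : Set ℕ) : ℝ :=
  limsup (fun n : ℕ => ((K ∩ Set.Icc 1 n).ncard : ℝ) / (n : ℝ)) atTop

/-- Index of convergence of the sequence `y` to the real number `L`:
`1 - sup_{ε > 0} δ₊ {n | y n ∉ ]L - ε, L + ε[}`. -/
def convIndex (y : ℕ → ℝ) (L : ℝ) : ℝ :=
  1 - ⨆ ε : {ε : ℝ // 0 < ε}, upperDensity {n | y n ∉ Set.Ioo (L - ε.1) (L + ε.1)}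

/-- Index of convergence of the sequence `y` to the set `A`:
`1 - sup_{ε > 0} δ₊ {n | y n ∉ A + ]-ε, ε[}`. -/
def convIndexSet (y : ℕ → ℝ) (A : Set ℝ) : ℝ :=
  1 - ⨆ ε : {ε : ℝ // 0 < ε}, upperDensity {n | y n ∉ A + Set.Ioo (-ε.1) ε.1}

/-! ### Lagrange operators at the Chebyshev nodes of the second kind -/

/-- `x_{n,k} = cos ((k - 1) π / (n - 1))`, for `k = 1, …, n`. -/
def chebNode (n k : ℕ) : ℝ :=
  Real.cos (((k : ℝ) - 1) / ((n : ℝ) - 1) * Real.pi)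

/-- The fundamental polynomial `ℓ_{n,k}(x) = ∏_{i ≠ k} (x - x_{n,i}) / (x_{n,k} - x_{n,i})`. -/
def fundPoly (n k : ℕ) : Polynomial ℝ :=
  Lagrange.basis (Finset.Icc 1 n) (chebNode n) k

/-- The Lagrange operator `L_n f (x) = ∑_{k=1}^n ℓ_{n,k}(x) f(x_{n,k})`.
It only uses the values of `f` on `[-1, 1]`. -/
def lagrangeOp (n : ℕ) (f : ℝ → ℝ) (x : ℝ) : ℝ :=
  ∑ k ∈ Finset.Icc 1 n, (fundPoly n k).eval x * f (chebNode n k)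

/-! ### The class `𝒞 + H` -/

/-- The modulus of continuity of `F` on `[-1, 1]`. -/
def modulusCont (F : ℝ → ℝ) (δ : ℝ) : ℝ :=
  sSup {r : ℝ | ∃ x ∈ Set.Icc (-1 : ℝ) 1, ∃ y ∈ Set.Icc (-1 : ℝ) 1,
    |x - y| ≤ δ ∧ r = |F x - F y|}

/-- The Dini–Lipschitz condition `ω(F, δ) = o(|log δ|⁻¹)` as `δ → 0+`. -/
def DiniLipschitz (F : ℝ → ℝ) : Prop :=
  (fun δ : ℝ => modulusCont F δ) =o[𝓝[>] (0 : ℝ)] (fun δ : ℝ => |Real.log δ|⁻¹)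

/-- The class `𝒞`: continuous on `[-1, 1]`, and monotone (increasing or decreasing) there or
satisfying the Dini–Lipschitz condition. -/
def classC : Set (ℝ → ℝ) :=
  {F | ContinuousOn F (Set.Icc (-1) 1) ∧
    (MonotoneOn F (Set.Icc (-1) 1) ∨ AntitoneOn F (Set.Icc (-1) 1) ∨ DiniLipschitz F)}

/-- The jump function `h_{x₀,d}`: `0` left of `x₀`, `d` at `x₀`, `1` right of `x₀`. -/
def jumpFun (x₀ d : ℝ) (x : ℝ) : ℝ :=
  if x < x₀ then 0 else if x = x₀ then d else 1

/-- The linear space `H` generated by the jump functions `h_{x₀,d}`, `x₀ ∈ ]-1, 1[`, `d ∈ ℝ`. -/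
def spaceH : Submodule ℝ (ℝ → ℝ) :=
  Submodule.span ℝ {h | ∃ x₀ ∈ Set.Ioo (-1 : ℝ) 1, ∃ d : ℝ, h = jumpFun x₀ d}

/-- `𝒞 + H`, as a class of functions on `[-1, 1]` (values outside `[-1, 1]` are irrelevant). -/
def classCH : Set (ℝ → ℝ) :=
  {f | ∃ F ∈ classC, ∃ h ∈ spaceH, Set.EqOn f (F + h) (Set.Icc (-1) 1)}

/-! ### The function `g` -/

/-- The Lerch zeta function `J(s, a) = ∑_{n=0}^∞ (-1)^n / (n + a)^s` (real `s > 0`, `a > 0`),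
as a conditionally convergent series, i.e. the limit of its partial sums. -/
def lerchJ (s a : ℝ) : ℝ :=
  ∑'[SummationFilter.conditional ℕ] n : ℕ, (-1 : ℝ) ^ n / ((n : ℝ) + a) ^ s

/-- The series defining `J(1, a)` converges: `lerchJ 1 a` is the limit of the partial sums. -/
theorem tendsto_lerchJ_one {a : ℝ} (ha : 0 < a) :
    Tendsto (fun N : ℕ => ∑ n ∈ Finset.range N, (-1 : ℝ) ^ n / ((n : ℝ) + a)) atTop
      (𝓝 (lerchJ 1 a)) := by
  have hanti : Antitone (fun n : ℕ => 1 / ((n : ℝ) + a)) := by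
    intro m n hmn
    have hm : (0 : ℝ) < (m : ℝ) + a := by positivity
    have : (m : ℝ) ≤ n := by exact_mod_cast hmn
    exact one_div_le_one_div_of_le hm (by linarith)
  have hlim : Tendsto (fun n : ℕ => 1 / ((n : ℝ) + a)) atTop (𝓝 0) := by
    simp only [one_div]
    exact tendsto_inv_atTop_zero.comp
      (tendsto_atTop_add_const_right _ a tendsto_natCast_atTop_atTop)
  obtain ⟨l, hl⟩ := hanti.tendsto_alternating_series_of_tendsto_zero hlim
  have hl' : Tendsto (fun N : ℕ => ∑ n ∈ Finset.range N, (-1 : ℝ) ^ n / ((n : ℝ) + a)) atTop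
      (𝓝 l) := by
    simpa [div_eq_mul_inv] using hl
  have hs : HasSum (fun n : ℕ => (-1 : ℝ) ^ n / ((n : ℝ) + a) ^ (1 : ℝ)) l
      (SummationFilter.conditional ℕ) := by
    rw [HasSum, SummationFilter.conditional_filter_eq_map_range, tendsto_map'_iff]
    simpa [Function.comp_def] using hl'
  rw [lerchJ, hs.tsum_eq]
  exact hl'

/-- `g(x) = (sin (π x) / π) J(1, x)`, considered for `x ∈ ]0, 1[`. -/
def gFun (x : ℝ) : ℝ :=
  Real.sin (Real.pi * x) / Real.pi * lerchJ 1 x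

/-! ### Peano–Jordan measure on the real line -/

/-- Elementary sets: finite unions of bounded closed intervals. -/
def IsElementary (E : Set ℝ) : Prop :=
  ∃ t : Finset (ℝ × ℝ), E = ⋃ p ∈ t, Set.Icc p.1 p.2

/-- Outer Peano–Jordan content of a bounded set. -/
def jordanOuter (A : Set ℝ) : ℝ :=
  sInf {r : ℝ | ∃ E, IsElementary E ∧ A ⊆ E ∧ r = volume.real E}

/-- Inner Peano–Jordan content of a bounded set. -/
def jordanInner (A : Set ℝ) : ℝ :=
  sSup {r : ℝ | ∃ E, IsElementary E ∧ E ⊆ A ∧ r = volume.real E}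

/-- `A` is Peano–Jordan measurable: bounded, with equal inner and outer content. The common
value, `jordanOuter A`, is then its Peano–Jordan measure. -/
def IsJordanMeasurable (A : Set ℝ) : Prop :=
  Bornology.IsBounded A ∧ jordanInner A = jordanOuter A

end

/-!
Write `x = cos θ` and `N = n - 1`. The nodes are `cos (j π / N)`, and
`ℓ_j (cos θ) = (-1) ^ (j + 1) sin θ sin (N θ) / (N (cos θ - cos (j π / N)))`, halved for `j = 0, N`
(`eval_fundPoly_cos`). If `N θ / π = i + t` with `0 < t < 1`, the nodes on either side of `θ` thus
contribute an alternating sum whose weights decrease and are at most `π / (m + 1)` at the `m`-th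
node away from `θ` (`lagrangeOp_cos`, `nodeWeight_le`). Halving the endpoint terms is exactly what
removes the boundary term in the summation by parts (`two_mul_altHalf`).

*Uniform convergence.* Summation by parts bounds `L_n f (x) - f (x)` by the size of `f - f (x)` near
`x` and by the oscillations of `f` between consecutive nodes, weighted by `1 / (m + 1)`
(`abs_altHalf_mul_le`). The weighted oscillations tend to zero for Dini–Lipschitz functions since
`∑ 1 / (m + 1)` is of order `log N`, and for monotone functions since the total variation is finite.
Jump functions are combinations of monotone ones, which are locally constant away from the jump, so
they are covered too. No Jackson theorem and no Lebesgue constants are needed.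

*At a jump.* For `f = h_{cos θ, d}` the alternating sum on one side remains, its `m`-th weight is
`sin (π t) / (π (m + t)) + O(1 / N)`, and alternating tails are small; hence `L_n f (cos θ)` is
asymptotic to `g (t)`, and equals `d` if `cos θ` is a node (`tendsto_lagrangeOp_jumpFun_sub`). Near
an interior point every function of the class `𝒞 + H` is a combination of two jump functions at that
point and of a function without jump there (`exists_decomposition_of_mem_classCH`). Consequently
`L_n f (x_i)` is asymptotic to `g_i (t_n)`, where `t_n` is the fractional part of `(n - 1) θ_i / π`,
and to `f (x_i)` along those `n` with `t_n = 0` (`tendsto_lagrangeOp_sub`).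

*Indices.* The function `g` is strictly decreasing on `]0, 1[`: both factors decrease on `[1/2, 1[`,
and `g (1 - x) = 1 - g (x)` by the reflection formula `lerchJ_add_lerchJ_one_sub`. If
`θ_i / π = p / q`, then `t_n` takes each value `m / q` with density `1 / q`, and the values
`g_i (m / q)` are distinct (`convIndex_eq_of_residues`). If `θ_i / π` is irrational, then `t_n` is
equidistributed by Weyl's criterion (`lowerDensityGE_fract`). Since `g` expands distances locally,
preimages of null sets are null, so that `g_i ⁻¹ (A)` has a null boundary whenever `A` has; its
content is then the limiting frequency (`convIndexSet_eq_of_irrational`).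
-/

/-! ### Alternating sums with a halved last term -/

/-- The alternating sum `u 0 - u 1 + ⋯ ± u (M - 1) ∓ u M / 2`, the last term being halved. -/
noncomputable def altHalf (u : ℕ → ℝ) (M : ℕ) : ℝ :=
  ∑ m ∈ Finset.range M, (-1 : ℝ) ^ m * u m + (-1 : ℝ) ^ M * u M / 2

/-- Summation by parts: halving the last term makes the boundary term at `M` disappear. -/
lemma two_mul_altHalf (u : ℕ → ℝ) (M : ℕ) :
    2 * altHalf u M = u 0 + ∑ m ∈ Finset.range M, (-1 : ℝ) ^ m * (u m - u (m + 1)) := by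
  induction M with
  | zero => simp [altHalf]; ring
  | succ M ih =>
    rw [Finset.sum_range_succ, ← add_assoc, ← ih]
    simp only [altHalf, Finset.sum_range_succ, pow_succ]
    ring

lemma altHalf_congr {u v : ℕ → ℝ} {M : ℕ} (h : ∀ m ≤ M, u m = v m) :
    altHalf u M = altHalf v M := by
  unfold altHalf
  rw [h M le_rfl]
  congr 1
  exact Finset.sum_congr rfl fun m hm => by rw [h m (Finset.mem_range.1 hm).le]

lemma altHalf_add (u : ℕ → ℝ) (K M : ℕ) :
    altHalf u (K + M) = ∑ m ∈ Finset.range K, (-1 : ℝ) ^ m * u m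
      + (-1 : ℝ) ^ K * altHalf (fun m => u (K + m)) M := by
  simp only [altHalf, Finset.sum_range_add, pow_add, mul_add, Finset.mul_sum]
  rw [add_assoc]
  congr 2
  · exact Finset.sum_congr rfl fun m _ => by ring
  · ring

lemma abs_two_mul_altHalf_le (u : ℕ → ℝ) (M : ℕ) :
    |2 * altHalf u M| ≤ |u 0| + ∑ m ∈ Finset.range M, |u m - u (m + 1)| := by
  rw [two_mul_altHalf]
  refine (abs_add_le _ _).trans (add_le_add_right ((Finset.abs_sum_le_sum_abs _ _).trans ?_) _)
  exact Finset.sum_le_sum fun m _ => by simp [abs_mul]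

lemma abs_altHalf_le_of_antitone {w : ℕ → ℝ} {M : ℕ} (hw : ∀ m < M, w (m + 1) ≤ w m)
    (hM : 0 ≤ w M) : |altHalf w M| ≤ w 0 := by
  have h := abs_two_mul_altHalf_le w M
  have h2 : ∑ m ∈ Finset.range M, |w m - w (m + 1)| = w 0 - w M := by
    rw [← Finset.sum_range_sub']
    exact Finset.sum_congr rfl fun m hm => by
      rw [abs_of_nonneg (sub_nonneg.2 (hw m (Finset.mem_range.1 hm)))]
  have h0 : w M ≤ w 0 := by
    have : 0 ≤ w 0 - w M := h2 ▸ Finset.sum_nonneg fun _ _ => abs_nonneg _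
    linarith
  rw [h2, abs_of_nonneg (hM.trans h0), abs_mul, abs_two] at h
  linarith

lemma abs_altSum_le_of_antitone {v : ℕ → ℝ} (hv : Antitone v) (h0 : ∀ m, 0 ≤ v m) (M : ℕ) :
    |∑ m ∈ Finset.range M, (-1 : ℝ) ^ m * v m| ≤ v 0 := by
  have h := abs_two_mul_altHalf_le v M
  have h2 : ∑ m ∈ Finset.range M, |v m - v (m + 1)| = v 0 - v M := by
    rw [← Finset.sum_range_sub']
    exact Finset.sum_congr rfl fun m _ => by
      rw [abs_of_nonneg (sub_nonneg.2 (hv m.le_succ))]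
  have h3 : ∑ m ∈ Finset.range M, (-1 : ℝ) ^ m * v m
      = (2 * altHalf v M - (-1 : ℝ) ^ M * v M) / 2 := by
    unfold altHalf; ring
  have h4 : |2 * altHalf v M - (-1 : ℝ) ^ M * v M| ≤ |2 * altHalf v M| + v M := by
    refine (abs_sub _ _).trans ?_
    simp [abs_mul, abs_of_nonneg (h0 M)]
  rw [h2, abs_of_nonneg (h0 0)] at h
  rw [h3, abs_div, abs_two]
  linarith

/-- The basic estimate: an alternating sum with decreasing weights `w m ≤ C / (m + 1)` is small
as soon as the factors `a m` are small for small `m` and their oscillations, weighted by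
`1 / (m + 1)`, have a small sum. -/
lemma abs_altHalf_mul_le {w a : ℕ → ℝ} {M K : ℕ} {C ε A : ℝ}
    (hw : ∀ m < M, w (m + 1) ≤ w m) (hw0 : ∀ m ≤ M, 0 ≤ w m)
    (hwC : ∀ m ≤ M, w m ≤ C / (m + 1)) (hA : ∀ m ≤ M, |a m| ≤ A)
    (hε0 : 0 ≤ ε) (hε : ∀ m ≤ K, m ≤ M → |a m| ≤ ε) :
    |altHalf (fun m => w m * a m) M| ≤ C * ε + C * A / (K + 1)
      + C * ∑ m ∈ Finset.range M, |a m - a (m + 1)| / (m + 1) := by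
  have hC : 0 ≤ C := by
    have := (hw0 0 (Nat.zero_le _)).trans (hwC 0 (Nat.zero_le _))
    simpa using this
  have hA0 : 0 ≤ A := (abs_nonneg _).trans (hA 0 (Nat.zero_le _))
  have hw0C : w 0 ≤ C := by simpa using hwC 0 (Nat.zero_le _)
  have hCA : 0 ≤ C * A / (K + 1) := by positivity
  have h := abs_two_mul_altHalf_le (fun m => w m * a m) M
  have hstep : ∀ m ∈ Finset.range M, |w m * a m - w (m + 1) * a (m + 1)| ≤
      C * (|a m - a (m + 1)| / (m + 1)) + |a (m + 1)| * (w m - w (m + 1)) := by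
    intro m hm
    have hm' := Finset.mem_range.1 hm
    have e : w m * a m - w (m + 1) * a (m + 1)
      = w m * (a m - a (m + 1)) + a (m + 1) * (w m - w (m + 1)) := by ring
    rw [e]
    refine (abs_add_le _ _).trans (add_le_add ?_ ?_)
    · rw [abs_mul, abs_of_nonneg (hw0 m hm'.le)]
      calc _ ≤ C / (m + 1) * |a m - a (m + 1)| :=
            mul_le_mul_of_nonneg_right (hwC m hm'.le) (abs_nonneg _)
        _ = _ := by ring
    · rw [abs_mul, abs_of_nonneg (sub_nonneg.2 (hw m hm'))]
  have hsum : ∑ m ∈ Finset.range M, |a (m + 1)| * (w m - w (m + 1))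
      ≤ C * ε + C * A / (K + 1) := by
    have htel : ∀ J ≤ M, ∑ m ∈ Finset.range J, |a (m + 1)| * (w m - w (m + 1)) ≤
        if J ≤ K then ε * (w 0 - w J) else ε * (w 0 - w K) + A * (w K - w J) := by
      intro J
      induction J with
      | zero => intro _; simp
      | succ J ih =>
        intro hJ
        have hih := ih (by omega)
        have hd := sub_nonneg.2 (hw J (by omega))
        rw [Finset.sum_range_succ]
        by_cases h1 : J + 1 ≤ K
        · rw [if_pos h1]
          rw [if_pos (by omega)] at hih
          have := mul_le_mul_of_nonneg_right (hε (J + 1) h1 hJ) hd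
          linarith
        · rw [if_neg h1]
          have := mul_le_mul_of_nonneg_right (hA (J + 1) hJ) hd
          by_cases h2 : J ≤ K
          · rw [if_pos h2] at hih
            obtain rfl : J = K := by omega
            linarith
          · rw [if_neg h2] at hih
            linarith
    refine (htel M le_rfl).trans ?_
    have hwM := hw0 M le_rfl
    split_ifs with h1
    · have : ε * (w 0 - w M) ≤ ε * C := mul_le_mul_of_nonneg_left (by linarith) hε0
      linarith
    · have hK := hwC K (by omega)
      have hK0 := hw0 K (by omega)
      have h3 : ε * (w 0 - w K) ≤ ε * C := mul_le_mul_of_nonneg_left (by linarith) hε0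
      have h4 : A * (w K - w M) ≤ A * (C / (K + 1)) :=
        mul_le_mul_of_nonneg_left (by linarith) hA0
      have h5 : A * (C / (K + 1)) = C * A / (K + 1) := by ring
      linarith
  have h1 := Finset.sum_le_sum hstep
  rw [Finset.sum_add_distrib, ← Finset.mul_sum] at h1
  have h0 : |w 0 * a 0| ≤ C * ε := by
    rw [abs_mul, abs_of_nonneg (hw0 0 (Nat.zero_le _))]
    exact mul_le_mul hw0C (hε 0 (Nat.zero_le _) (Nat.zero_le _)) (abs_nonneg _) hC
  have h5 : 0 ≤ C * ∑ m ∈ Finset.range M, |a m - a (m + 1)| / (m + 1) :=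
    mul_nonneg hC (Finset.sum_nonneg fun m _ => by positivity)
  rw [abs_mul, abs_two] at h
  linarith

/-! ### The fundamental polynomials in terms of the angle -/

lemma chebNode_succ (N j : ℕ) :
    chebNode (N + 1) (j + 1) = Real.cos (j * Real.pi / N) := by
  unfold chebNode
  congr 1
  push_cast
  rw [add_sub_cancel_right, add_sub_cancel_right]
  ring

lemma chebNode_mem_Icc (n k : ℕ) : chebNode n k ∈ Icc (-1 : ℝ) 1 :=
  ⟨Real.neg_one_le_cos _, Real.cos_le_one _⟩

lemma angle_mem_Icc {N j : ℕ} (hN : 0 < N) (hj : j ≤ N) :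
    (j : ℝ) * Real.pi / N ∈ Icc 0 Real.pi := by
  have hN' : (0 : ℝ) < N := by exact_mod_cast hN
  have hj' : (j : ℝ) ≤ N := by exact_mod_cast hj
  have hpi := Real.pi_pos
  refine ⟨by positivity, ?_⟩
  rw [div_le_iff₀ hN']
  nlinarith

lemma chebNode_injOn {N : ℕ} (hN : 0 < N) :
    Set.InjOn (chebNode (N + 1)) (Finset.Icc 1 (N + 1) : Finset ℕ) := by
  intro a ha b hb hab
  simp only [Finset.coe_Icc, Set.mem_Icc] at ha hb
  obtain ⟨i, rfl⟩ := Nat.exists_eq_add_of_le' ha.1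
  obtain ⟨j, rfl⟩ := Nat.exists_eq_add_of_le' hb.1
  rw [chebNode_succ, chebNode_succ] at hab
  have h := Real.injOn_cos (angle_mem_Icc hN (by omega)) (angle_mem_Icc hN (by omega)) hab
  have hN' : (N : ℝ) ≠ 0 := by positivity
  have hpi := Real.pi_ne_zero
  field_simp at h
  have : i = j := by exact_mod_cast h
  omega

lemma lagrangeOp_eq_self_of_node {N j : ℕ} (hN : 0 < N) (hj : j ≤ N) (f : ℝ → ℝ) :
    lagrangeOp (N + 1) f (Real.cos (j * Real.pi / N)) = f (Real.cos (j * Real.pi / N)) := by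
  rw [← chebNode_succ]
  have hmem : j + 1 ∈ Finset.Icc 1 (N + 1) := by simp [hj]
  unfold lagrangeOp fundPoly
  rw [Finset.sum_eq_single (j + 1)]
  · rw [Lagrange.eval_basis_self (chebNode_injOn hN) hmem, one_mul]
  · intro k _ hk
    rw [Lagrange.eval_basis_of_ne hk hmem, zero_mul]
  · exact fun h => absurd hmem h

lemma lagrangeOp_sub_eq {N : ℕ} (hN : 0 < N) (f : ℝ → ℝ) (c x : ℝ) :
    lagrangeOp (N + 1) f x - c = lagrangeOp (N + 1) (fun z => f z - c) x := by
  have h := congrArg (Polynomial.eval x)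
    (Lagrange.sum_basis (chebNode_injOn hN) (Finset.nonempty_Icc.2 (by omega)))
  rw [Polynomial.eval_finsetSum, Polynomial.eval_one] at h
  have : c = ∑ k ∈ Finset.Icc 1 (N + 1), (fundPoly (N + 1) k).eval x * c := by
    rw [← Finset.sum_mul]
    unfold fundPoly
    rw [h, one_mul]
  conv_lhs => rw [this]
  unfold lagrangeOp
  rw [← Finset.sum_sub_distrib]
  exact Finset.sum_congr rfl fun k _ => by ring

open Polynomial in
/-- The nodal polynomial of the Chebyshev nodes of the second kind is proportional to
`(1 - X ^ 2) * U_{N - 1}`. -/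
lemma exists_nodal_chebNode (K : ℕ) : ∃ c : ℝ, c ≠ 0 ∧
    (1 - X ^ 2) * Chebyshev.U ℝ K
      = C c * Lagrange.nodal (Finset.Icc 1 (K + 2)) (chebNode (K + 2)) := by
  set W : ℝ[X] := (1 - X ^ 2) * Chebyshev.U ℝ K with hW
  have h1 : (1 - X ^ 2 : ℝ[X]) ≠ 0 := by
    intro h
    have := congrArg (Polynomial.eval 0) h
    simp at this
  have hW0 : W ≠ 0 := mul_ne_zero h1 (fun h => by
    have := congrArg (Polynomial.eval 1) h
    rw [Chebyshev.U_eval_one] at this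
    simp only [Int.cast_natCast, eval_zero] at this
    exact (Nat.cast_add_one_pos K).ne' this)
  have hdvd : Lagrange.nodal (Finset.Icc 1 (K + 2)) (chebNode (K + 2)) ∣ W := by
    rw [Lagrange.nodal_eq]
    refine Finset.prod_dvd_of_coprime ?_ ?_
    · intro a ha b hb hab
      exact Polynomial.pairwise_coprime_X_sub_C (s := fun x : ℝ => x) (fun _ _ h => h)
        (fun h => hab (chebNode_injOn (Nat.succ_pos K) ha hb h))
    · intro k hk
      obtain ⟨hk1, hk2⟩ := Finset.mem_Icc.1 hk
      obtain ⟨j, rfl⟩ := Nat.exists_eq_add_of_le' hk1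
      rw [Polynomial.dvd_iff_isRoot, Polynomial.IsRoot.def, chebNode_succ]
      have hU := Polynomial.Chebyshev.U_real_cos (j * Real.pi / (K + 1 : ℕ)) K
      have hs : Real.sin (((K : ℤ) + 1 : ℝ) * (j * Real.pi / (K + 1 : ℕ))) = 0 := by
        have e : ((K : ℤ) + 1 : ℝ) * (j * Real.pi / (K + 1 : ℕ)) = j * Real.pi := by
          push_cast
          field_simp
        rw [e, Real.sin_nat_mul_pi]
      rw [hs] at hU
      simp only [hW, eval_mul, eval_sub, eval_one, eval_pow, eval_X]
      rw [← Real.sin_sq, sq, mul_assoc, mul_comm (Real.sin _) (eval _ _), hU, mul_zero]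
  have hdeg : W.natDegree ≤
        (Lagrange.nodal (Finset.Icc 1 (K + 2)) (chebNode (K + 2))).natDegree := by
    rw [Lagrange.natDegree_nodal, Nat.card_Icc]
    refine natDegree_mul_le.trans ?_
    have h2 : (1 - X ^ 2 : ℝ[X]).natDegree ≤ 2 := by compute_degree
    have h3 := Chebyshev.natDegree_U_natCast ℝ K
    omega
  have := eq_leadingCoeff_mul_of_monic_of_dvd_of_natDegree_le Lagrange.nodal_monic hdvd hdeg
  exact ⟨_, leadingCoeff_ne_zero.2 hW0, this⟩

open Polynomial in
/-- At a node `cos (j π / N)`, the derivative of `(1 - X ^ 2) * U_{N - 1}` is `-N (-1) ^ j`, and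
twice this value at the two endpoints. -/
lemma eval_derivative_at_node {K j : ℕ} (hj : j ≤ K + 1) :
    eval (Real.cos (j * Real.pi / (K + 1 : ℕ))) (derivative ((1 - X ^ 2) * Chebyshev.U ℝ K))
      = -((K + 1 : ℕ) : ℝ) * (-1) ^ j * (if j = 0 ∨ j = K + 1 then 2 else 1) := by
  have hder : derivative ((1 - X ^ 2) * Chebyshev.U ℝ K)
      = -(X * Chebyshev.U ℝ K + ((K : ℝ[X]) + 1) * Chebyshev.T ℝ (K + 1)) := by
    have h := Chebyshev.add_one_mul_T_eq_poly_in_U (R := ℝ) K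
    simp only [Int.cast_natCast] at h
    rw [h, derivative_mul]
    simp only [derivative_sub, derivative_one, derivative_X_pow]
    simp only [zero_sub, Nat.cast_ofNat, Nat.add_one_sub_one, pow_one, map_ofNat]
    ring
  rw [hder]
  simp only [eval_neg, eval_add, eval_mul, eval_X, eval_natCast, eval_one]
  have hT : (Chebyshev.T ℝ ((K : ℤ) + 1)).eval (Real.cos (j * Real.pi / (K + 1 : ℕ)))
      = (-1) ^ j := by
    rw [Chebyshev.T_real_cos]
    rw [← Real.cos_nat_mul_pi]
    congr 1
    push_cast
    field_simp
  rw [hT]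
  rcases eq_or_ne j 0 with rfl | h0
  · simp
    ring
  rcases eq_or_ne j (K + 1) with rfl | h1
  · have : ((K + 1 : ℕ) : ℝ) * Real.pi / (K + 1 : ℕ) = Real.pi := by
      field_simp
    rw [this, Real.cos_pi, Chebyshev.U_eval_neg_one]
    rw [if_pos (Or.inr rfl)]
    have : (((K : ℤ).negOnePow : ℤ) : ℝ) = (-1) ^ K := by
      rw [Int.negOnePow_def]; simp
    rw [this]
    push_cast
    ring
  · rw [if_neg (by tauto)]
    have hU := Chebyshev.U_real_cos (j * Real.pi / (K + 1 : ℕ)) K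
    have hs : Real.sin (((K : ℤ) + 1 : ℝ) * (j * Real.pi / (K + 1 : ℕ))) = 0 := by
      have e : ((K : ℤ) + 1 : ℝ) * (j * Real.pi / (K + 1 : ℕ)) = j * Real.pi := by
        push_cast
        field_simp
      rw [e, Real.sin_nat_mul_pi]
    rw [hs] at hU
    have hsin : Real.sin (j * Real.pi / (K + 1 : ℕ)) ≠ 0 := by
      refine (Real.sin_pos_of_pos_of_lt_pi ?_ ?_).ne'
      · have : (0 : ℝ) < j := by exact_mod_cast Nat.pos_of_ne_zero h0
        have := Real.pi_pos
        positivity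
      · have : (j : ℝ) < (K + 1 : ℕ) := by exact_mod_cast lt_of_le_of_ne hj h1
        rw [div_lt_iff₀ (by positivity)]
        nlinarith [Real.pi_pos]
    have hU0 := (mul_eq_zero.1 hU).resolve_right hsin
    rw [hU0]
    push_cast
    ring

open Polynomial in
lemma eval_fundPoly_cos {N j : ℕ} (hN : 0 < N) (hj : j ≤ N) {θ : ℝ}
    (hθ : Real.cos θ ≠ Real.cos (j * Real.pi / N)) :
    (fundPoly (N + 1) (j + 1)).eval (Real.cos θ) =
      (-1) ^ (j + 1) * (Real.sin θ * Real.sin (N * θ)) /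
        (N * (Real.cos θ - Real.cos (j * Real.pi / N))) / (if j = 0 ∨ j = N then 2 else 1) := by
  obtain ⟨K, rfl⟩ := Nat.exists_eq_add_of_le' hN
  obtain ⟨c, hc, hW⟩ := exists_nodal_chebNode K
  have hmem : j + 1 ∈ Finset.Icc 1 (K + 1 + 1) := by simp [hj]
  have hd := eval_derivative_at_node hj
  rw [hW, derivative_C_mul, eval_mul, eval_C] at hd
  have hx : eval (Real.cos θ) ((1 - X ^ 2) * Chebyshev.U ℝ K)
      = Real.sin θ * Real.sin ((K + 1 : ℕ) * θ) := by
    have hU := Chebyshev.U_real_cos θ K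
    simp only [eval_mul, eval_sub, eval_one, eval_pow, eval_X]
    push_cast at hU ⊢
    rw [← hU, ← Real.sin_sq]
    ring
  rw [hW, eval_mul, eval_C] at hx
  unfold fundPoly
  rw [Lagrange.eval_basis_not_at_node hmem (by rwa [chebNode_succ]),
    Lagrange.nodalWeight_eq_eval_derivative_nodal hmem, chebNode_succ, ← hx]
  have hs : (-1 : ℝ) ^ j * (-1) ^ j = 1 := by rw [← mul_pow]; simp
  set D := eval (Real.cos (j * Real.pi / (K + 1 : ℕ)))
    (derivative (Lagrange.nodal (Finset.Icc 1 (K + 2)) (chebNode (K + 2)))) with hD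
  have hne := sub_ne_zero.2 hθ
  set E := eval (Real.cos θ) (Lagrange.nodal (Finset.Icc 1 (K + 2)) (chebNode (K + 2)))
  set κ : ℝ := if j = 0 ∨ j = K + 1 then 2 else 1 with hκ
  have hκ0 : κ ≠ 0 := by rw [hκ]; split_ifs <;> norm_num
  have hN0 : ((K + 1 : ℕ) : ℝ) ≠ 0 := by positivity
  have hs0 : (-1 : ℝ) ^ j ≠ 0 := by positivity
  have hD' : D = -((K + 1 : ℕ) : ℝ) * (-1) ^ j * κ / c := by
    rw [← hd]; field_simp
  rw [hD', pow_succ]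
  have hs1 : ((-1 : ℝ) ^ j) ^ 2 = 1 := by rw [sq]; exact hs
  field_simp
  rw [hs1]
  ring

/-! ### The Lagrange operator as two alternating sums -/

/-- The weight of the `m`-th node to the left of the angle `θ`, i.e. the node at angle
`θ - (τ + m) π / N`, in the Lagrange operator with `N + 1` nodes; signs are left out. -/
noncomputable def nodeWeight (N : ℕ) (θ τ : ℝ) (m : ℕ) : ℝ :=
  Real.sin θ * Real.sin (Real.pi * τ) /
    (N * (Real.cos (θ - (τ + m) * Real.pi / N) - Real.cos θ))

/-- For `0 < θ < π` with `N θ / π = i + t`, `0 < t < 1`, the nodes with angle `< θ` and those with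
angle `> θ` contribute one alternating sum each. The second one is the first one after the
reflection `θ ↦ π - θ`. -/
lemma lagrangeOp_cos {N i : ℕ} (hN : 0 < N) {θ t : ℝ} (hθ : θ ∈ Ioo 0 Real.pi)
    (ht : t ∈ Ioo (0 : ℝ) 1) (hi : N * θ / Real.pi = i + t) (f : ℝ → ℝ) :
    lagrangeOp (N + 1) f (Real.cos θ) =
      altHalf (fun m => nodeWeight N θ t m * f (Real.cos (θ - (t + m) * Real.pi / N))) i +
      altHalf (fun m => nodeWeight N (Real.pi - θ) (1 - t) m *
        f (-Real.cos (Real.pi - θ - (1 - t + m) * Real.pi / N))) (N - 1 - i) := by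
  have hpi := Real.pi_pos
  have hN' : (0 : ℝ) < N := by exact_mod_cast hN
  have hθi : θ = (i + t) * Real.pi / N := by
    rw [← hi]; field_simp
  have hiN : i < N := by
    have : (i : ℝ) < N := by
      have h1 : N * θ / Real.pi < N := by
        rw [div_lt_iff₀ hpi]; exact mul_lt_mul_of_pos_left hθ.2 hN'
      linarith [ht.1]
    exact_mod_cast this
  have hsin : Real.sin (N * θ) = (-1) ^ i * Real.sin (Real.pi * t) := by
    have : N * θ = Real.pi * t + i * Real.pi := by
      rw [hθi]; field_simp; ring
    rw [this, Real.sin_add_nat_mul_pi]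
  have hne : ∀ j ≤ N, Real.cos θ ≠ Real.cos (j * Real.pi / N) := by
    intro j hj h
    have h := Real.injOn_cos (Ioo_subset_Icc_self hθ) (angle_mem_Icc hN hj) h
    rw [hθi] at h
    field_simp at h
    have h1 : ((i : ℤ) : ℝ) < (j : ℤ) := by push_cast; linarith [ht.1]
    have h2 : ((j : ℤ) : ℝ) < ((i + 1 : ℤ) : ℝ) := by push_cast; linarith [ht.2]
    have h1' := Int.cast_lt.1 h1
    have h2' := Int.cast_lt.1 h2
    omega
  have hsum : lagrangeOp (N + 1) f (Real.cos θ) = ∑ j ∈ Finset.range (N + 1),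
      (-1) ^ (j + 1) * (Real.sin θ * Real.sin (N * θ)) /
        (N * (Real.cos θ - Real.cos (j * Real.pi / N))) / (if j = 0 ∨ j = N then 2 else 1) *
          f (Real.cos (j * Real.pi / N)) := by
    unfold lagrangeOp
    rw [← Finset.Ico_add_one_right_eq_Icc, Finset.sum_Ico_eq_sum_range]
    refine Finset.sum_congr rfl fun j hj => ?_
    have hj' : j ≤ N := by have := Finset.mem_range.1 hj; omega
    rw [add_comm 1 j, eval_fundPoly_cos hN hj' (hne j hj'), chebNode_succ]
  rw [hsum]
  obtain ⟨M, rfl⟩ : ∃ M, N = i + 1 + M := Nat.exists_eq_add_of_le hiN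
  have hM : i + 1 + M - 1 - i = M := by omega
  rw [hM, show i + 1 + M + 1 = (i + 1) + (M + 1) by ring, Finset.sum_range_add]
  congr 1
  · rw [← Finset.sum_range_reflect, altHalf, Finset.sum_range_succ]
    have key : ∀ m ≤ i, (Real.cos ((i + 1 - 1 - m : ℕ) * Real.pi / (i + 1 + M : ℕ))
        = Real.cos (θ - (t + m) * Real.pi / (i + 1 + M : ℕ))) ∧
        (-1 : ℝ) ^ (i + 1 - 1 - m + 1) * (-1) ^ i = - (-1) ^ m := by
      intro m hm
      constructor
      · congr 1
        rw [hθi, Nat.cast_sub (by omega), Nat.cast_sub (by omega)]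
        push_cast
        ring
      · obtain ⟨l, rfl⟩ := Nat.exists_eq_add_of_le hm
        rw [show m + l + 1 - 1 - m + 1 = l + 1 by omega, ← pow_add,
          show l + 1 + (m + l) = 2 * l + (m + 1) by ring, pow_add, pow_mul]
        simp [pow_succ]
    have hform : ∀ m ≤ i, (-1) ^ (i + 1 - 1 - m + 1) * (Real.sin θ * Real.sin ((i + 1 + M : ℕ) * θ)) /
        ((i + 1 + M : ℕ) * (Real.cos θ - Real.cos ((i + 1 - 1 - m : ℕ) * Real.pi / (i + 1 + M : ℕ))))
        = (-1) ^ m * nodeWeight (i + 1 + M) θ t m := by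
      intro m hm
      obtain ⟨k1, k2⟩ := key m hm
      rw [k1, hsin, nodeWeight]
      have e : (-1 : ℝ) ^ (i + 1 - 1 - m + 1) * (Real.sin θ * ((-1) ^ i * Real.sin (Real.pi * t)))
        = - ((-1) ^ m * (Real.sin θ * Real.sin (Real.pi * t))) := by
        linear_combination (Real.sin θ * Real.sin (Real.pi * t)) * k2
      rw [e, ← neg_sub (Real.cos (θ - _)), mul_neg, neg_div_neg_eq, mul_div_assoc]
    congr 1
    · refine Finset.sum_congr rfl fun m hm => ?_
      have hm' := Finset.mem_range.1 hm
      rw [if_neg (by omega), div_one, hform m hm'.le, (key m hm'.le).1]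
      ring
    · rw [if_pos (by omega), hform i le_rfl, (key i le_rfl).1]
      ring
  · rw [altHalf, Finset.sum_range_succ]
    have key : ∀ m ≤ M, (Real.cos ((i + 1 + m : ℕ) * Real.pi / (i + 1 + M : ℕ))
        = -Real.cos (Real.pi - θ - (1 - t + m) * Real.pi / (i + 1 + M : ℕ))) ∧
        (-1 : ℝ) ^ (i + 1 + m + 1) * (-1) ^ i = (-1) ^ m := by
      intro m hm
      constructor
      · rw [sub_sub, Real.cos_pi_sub, neg_neg]
        congr 1
        rw [hθi]
        push_cast
        ring
      · rw [← pow_add, show i + 1 + m + 1 + i = 2 * (i + 1) + m by ring, pow_add, pow_mul]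
        simp
    have hform : ∀ m ≤ M, (-1) ^ (i + 1 + m + 1) * (Real.sin θ * Real.sin ((i + 1 + M : ℕ) * θ)) /
        ((i + 1 + M : ℕ) * (Real.cos θ - Real.cos ((i + 1 + m : ℕ) * Real.pi / (i + 1 + M : ℕ))))
        = (-1) ^ m * nodeWeight (i + 1 + M) (Real.pi - θ) (1 - t) m := by
      intro m hm
      obtain ⟨k1, k2⟩ := key m hm
      rw [k1, hsin, nodeWeight, Real.sin_pi_sub, Real.cos_pi_sub,
        show Real.pi * (1 - t) = Real.pi - Real.pi * t by ring, Real.sin_pi_sub]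
      have e : (-1 : ℝ) ^ (i + 1 + m + 1) * (Real.sin θ * ((-1) ^ i * Real.sin (Real.pi * t)))
        = ((-1) ^ m * (Real.sin θ * Real.sin (Real.pi * t))) := by
        linear_combination (Real.sin θ * Real.sin (Real.pi * t)) * k2
      rw [e, sub_neg_eq_add, sub_neg_eq_add, add_comm (Real.cos θ), mul_div_assoc]
    congr 1
    · refine Finset.sum_congr rfl fun m hm => ?_
      have hm' := Finset.mem_range.1 hm
      rw [if_neg (by omega), div_one, hform m hm'.le, (key m hm'.le).1]
      ring
    · rw [if_pos (by omega), hform M le_rfl, (key M le_rfl).1]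
      ring

/-! ### Estimates for the weights -/

lemma sin_mul_le_cos_sub_cos {θ δ : ℝ} (hθ : θ ∈ Ioo 0 Real.pi) (hδ : δ ∈ Icc 0 θ) :
    Real.sin θ * (δ / Real.pi) ≤ Real.cos (θ - δ) - Real.cos θ := by
  have hpi := Real.pi_pos
  have hs := Real.sin_pos_of_pos_of_lt_pi hθ.1 hθ.2
  rw [Real.cos_sub_cos, show (θ - δ + θ) / 2 = θ - δ / 2 by ring,
    show (θ - δ - θ) / 2 = -(δ / 2) by ring, Real.sin_neg]
  have h1 : 2 / Real.pi * (δ / 2) ≤ Real.sin (δ / 2) :=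
    Real.mul_le_sin (by linarith [hδ.1]) (by linarith [hδ.2, hθ.2])
  -- By concavity of the sine, its value at `θ - δ / 2 ∈ [θ / 2, θ]` is at least `sin θ / 2`.
  have h2 : Real.sin θ / 2 ≤ Real.sin (θ - δ / 2) := by
    have hc := strictConcaveOn_sin_Icc.concaveOn.2 (left_mem_Icc.2 hpi.le)
      (Ioo_subset_Icc_self hθ)
      (show 0 ≤ δ / 2 / θ by have := hδ.1; have := hθ.1; positivity)
      (show 0 ≤ 1 - δ / 2 / θ by
        rw [sub_nonneg, div_le_one hθ.1]
        linarith [hδ.1, hδ.2])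
      (by ring)
    have h3 : δ / 2 / θ ≤ 1 / 2 := by
      rw [div_le_iff₀ hθ.1]; linarith [hδ.2]
    have e : (1 - δ / 2 / θ) * θ = θ - δ / 2 := by
      have := hθ.1.ne'
      field_simp
    simp only [smul_eq_mul, Real.sin_zero, mul_zero, zero_add, e] at hc
    nlinarith
  have h4 : 0 ≤ δ / 2 := by linarith [hδ.1]
  have h5 : 2 / Real.pi * (δ / 2) = δ / Real.pi := by ring
  rw [h5] at h1
  have h6 : 0 ≤ δ / Real.pi := by have := hδ.1; positivity
  nlinarith [mul_le_mul h2 h1 h6 (by linarith)]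

lemma sin_pi_mul_div_le {τ : ℝ} (hτ : τ ∈ Ioo (0 : ℝ) 1) (m : ℕ) :
    Real.sin (Real.pi * τ) / (τ + m) ≤ Real.pi / (m + 1) := by
  have h1 : Real.sin (Real.pi * τ) ≤ Real.pi * τ := Real.sin_le (by have := hτ.1; positivity)
  have hτ0 := hτ.1
  have hm : (0 : ℝ) ≤ m := m.cast_nonneg
  rw [div_le_div_iff₀ (by positivity) (by positivity)]
  have h2 : τ * (m + 1) ≤ τ + m := by nlinarith [hτ.2]
  nlinarith [Real.pi_pos]

section
variable {N : ℕ} {θ τ : ℝ}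

lemma angle_step_pos (hN : 0 < N) (hτ : τ ∈ Ioo (0 : ℝ) 1) (m : ℕ) :
    0 < (τ + m) * Real.pi / N := by
  have hN' : (0 : ℝ) < N := by exact_mod_cast hN
  have := hτ.1
  have := Real.pi_pos
  positivity

lemma sin_pi_mul_pos (hτ : τ ∈ Ioo (0 : ℝ) 1) : 0 < Real.sin (Real.pi * τ) :=
  Real.sin_pos_of_pos_of_lt_pi (mul_pos Real.pi_pos hτ.1) (by nlinarith [hτ.2, Real.pi_pos])

lemma cos_sub_cos_pos (hN : 0 < N) (hθ : θ ∈ Ioo 0 Real.pi) (hτ : τ ∈ Ioo (0 : ℝ) 1) {m : ℕ}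
    (hm : (τ + m) * Real.pi / N ≤ θ) :
    0 < Real.cos (θ - (τ + m) * Real.pi / N) - Real.cos θ := by
  have h := sin_mul_le_cos_sub_cos hθ ⟨(angle_step_pos hN hτ m).le, hm⟩
  have hs := Real.sin_pos_of_pos_of_lt_pi hθ.1 hθ.2
  exact (mul_pos hs (div_pos (angle_step_pos hN hτ m) Real.pi_pos)).trans_le h

lemma nodeWeight_nonneg (hN : 0 < N) (hθ : θ ∈ Ioo 0 Real.pi) (hτ : τ ∈ Ioo (0 : ℝ) 1) {m : ℕ}
    (hm : (τ + m) * Real.pi / N ≤ θ) : 0 ≤ nodeWeight N θ τ m := by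
  have h := cos_sub_cos_pos hN hθ hτ hm
  have hs := Real.sin_pos_of_pos_of_lt_pi hθ.1 hθ.2
  have := sin_pi_mul_pos hτ
  unfold nodeWeight
  positivity

lemma nodeWeight_le (hN : 0 < N) (hθ : θ ∈ Ioo 0 Real.pi) (hτ : τ ∈ Ioo (0 : ℝ) 1) {m : ℕ}
    (hm : (τ + m) * Real.pi / N ≤ θ) : nodeWeight N θ τ m ≤ Real.pi / (m + 1) := by
  refine le_trans ?_ (sin_pi_mul_div_le hτ m)
  have h := sin_mul_le_cos_sub_cos hθ ⟨(angle_step_pos hN hτ m).le, hm⟩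
  have h0 := cos_sub_cos_pos hN hθ hτ hm
  have hs := Real.sin_pos_of_pos_of_lt_pi hθ.1 hθ.2
  have ht := sin_pi_mul_pos hτ
  have hN' : (0 : ℝ) < N := by exact_mod_cast hN
  have hτm : 0 < τ + m := by have := hτ.1; positivity
  unfold nodeWeight
  rw [div_le_div_iff₀ (by positivity) hτm]
  have e : Real.sin θ * ((τ + m) * Real.pi / N / Real.pi) = Real.sin θ * (τ + m) / N := by
    have := Real.pi_ne_zero
    field_simp
  rw [e, div_le_iff₀ hN'] at h
  nlinarith

lemma nodeWeight_succ_le (hN : 0 < N) (hθ : θ ∈ Ioo 0 Real.pi) (hτ : τ ∈ Ioo (0 : ℝ) 1) {m : ℕ}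
    (hm : (τ + (m + 1 : ℕ)) * Real.pi / N ≤ θ) :
    nodeWeight N θ τ (m + 1) ≤ nodeWeight N θ τ m := by
  have hN' : (0 : ℝ) < N := by exact_mod_cast hN
  have hstep : (τ + m) * Real.pi / N ≤ (τ + (m + 1 : ℕ)) * Real.pi / N := by
    have := Real.pi_pos
    push_cast
    gcongr
    linarith
  have h0 := cos_sub_cos_pos hN hθ hτ (hstep.trans hm)
  have hs := Real.sin_pos_of_pos_of_lt_pi hθ.1 hθ.2
  have ht := sin_pi_mul_pos hτ
  unfold nodeWeight
  refine div_le_div_of_nonneg_left (by positivity) (by positivity) ?_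
  gcongr
  refine Real.cos_le_cos_of_nonneg_of_le_pi (by linarith) ?_ (by linarith)
  linarith [hθ.2, angle_step_pos hN hτ m]

end

/-! ### Uniform convergence away from the jumps -/

/-- A finite sequence of points of `[-1, 1]` resembling the nodes on one side of the point `x`:
monotone, with steps at most `π / N`, the `m`-th point being within `(m + 1) π / N` of `x`. -/
structure IsNodeChain (N M : ℕ) (x : ℝ) (P : ℕ → ℝ) : Prop where
  mem : ∀ m ≤ M, P m ∈ Icc (-1 : ℝ) 1
  mono : (∀ m < M, P m ≤ P (m + 1)) ∨ (∀ m < M, P (m + 1) ≤ P m)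
  step : ∀ m < M, |P m - P (m + 1)| ≤ Real.pi / N
  near : ∀ m ≤ M, |P m - x| ≤ (m + 1) * (Real.pi / N)
  len : M ≤ N

/-- The oscillations of `f` along node chains starting near points of `W`, weighted by the size
`1 / (m + 1)` of the fundamental polynomials, tend to zero. -/
def SmallOscillation (f : ℝ → ℝ) (W : Set ℝ) : Prop :=
  ∀ ε > 0, ∀ᶠ N : ℕ in atTop, ∀ x ∈ W, ∀ M P, IsNodeChain N M x P →
    ∑ m ∈ Finset.range M, |f (P m) - f (P (m + 1))| / (m + 1) ≤ ε

/-- `f` is uniformly continuous at the points of `W`, as a function on `[-1, 1]`. -/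
def UniformContAt (f : ℝ → ℝ) (W : Set ℝ) : Prop :=
  ∀ ε > 0, ∃ δ > 0, ∀ x ∈ W, ∀ z ∈ Icc (-1 : ℝ) 1, |z - x| < δ → |f z - f x| ≤ ε

lemma isNodeChain_cos {N M : ℕ} {θ τ s : ℝ} (hN : 0 < N) (hθ : θ ∈ Ioo 0 Real.pi)
    (hτ : τ ∈ Ioo (0 : ℝ) 1) (hM : (τ + M) * Real.pi / N = θ) (hs : s = 1 ∨ s = -1) :
    IsNodeChain N M (s * Real.cos θ) (fun m => s * Real.cos (θ - (τ + m) * Real.pi / N)) := by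
  have hpi := Real.pi_pos
  have hN' : (0 : ℝ) < N := by exact_mod_cast hN
  have hcos : ∀ u v : ℝ, |s * Real.cos u - s * Real.cos v| ≤ |u - v| := by
    intro u v
    rw [← mul_sub, abs_mul, show |s| = 1 by rcases hs with rfl | rfl <;> simp, one_mul]
    have := Real.lipschitzWith_cos.dist_le_mul u v
    simpa [Real.dist_eq] using this
  have hmono : ∀ m < M, Real.cos (θ - (τ + m) * Real.pi / N)
      ≤ Real.cos (θ - (τ + (m + 1 : ℕ)) * Real.pi / N) := by
    intro m hm
    have hmM : ((m + 1 : ℕ) : ℝ) ≤ M := by exact_mod_cast hm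
    have h1 : (τ + (m + 1 : ℕ)) * Real.pi / N ≤ θ := by
      rw [← hM]; gcongr
    have h2 : (τ + m) * Real.pi / N ≤ (τ + (m + 1 : ℕ)) * Real.pi / N := by
      push_cast
      gcongr
      linarith
    refine Real.cos_le_cos_of_nonneg_of_le_pi (by linarith) ?_ (by linarith)
    linarith [hθ.2, angle_step_pos hN hτ m]
  refine ⟨fun m _ => ?_, ?_, fun m _ => ?_, fun m _ => ?_, ?_⟩
  · have h1 := Real.neg_one_le_cos (θ - (τ + m) * Real.pi / N)
    have h2 := Real.cos_le_one (θ - (τ + m) * Real.pi / N)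
    rcases hs with rfl | rfl <;> constructor <;> linarith
  · rcases hs with rfl | rfl
    · left; intro m hm; simpa using hmono m hm
    · right; intro m hm; simpa using hmono m hm
  · refine (hcos _ _).trans (le_of_eq ?_)
    rw [show θ - (τ + m) * Real.pi / N - (θ - (τ + (m + 1 : ℕ)) * Real.pi / N)
      = Real.pi / N by push_cast; ring]
    exact abs_of_pos (by positivity)
  · refine (hcos _ _).trans ?_
    rw [show θ - (τ + m) * Real.pi / N - θ = -((τ + m) * (Real.pi / N)) by ring, abs_neg,
      abs_of_nonneg (by have := hτ.1; positivity)]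
    exact mul_le_mul_of_nonneg_right (by linarith [hτ.2]) (by positivity)
  · have h : (τ + M) * Real.pi / N < Real.pi := by rw [hM]; exact hθ.2
    rw [div_lt_iff₀ hN', mul_comm] at h
    have h2 := lt_of_mul_lt_mul_left h hpi.le
    have : (M : ℝ) ≤ N := by linarith [hτ.1]
    exact_mod_cast this

/-- The contribution of the nodes on one side of the point. -/
lemma abs_altHalf_nodeWeight_le {N M K : ℕ} {θ τ : ℝ} (hN : 0 < N) (hθ : θ ∈ Ioo 0 Real.pi)
    (hτ : τ ∈ Ioo (0 : ℝ) 1) (hM : (τ + M) * Real.pi / N = θ) {a : ℕ → ℝ} {ε A : ℝ}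
    (hA : ∀ m ≤ M, |a m| ≤ A) (hε0 : 0 ≤ ε) (hε : ∀ m ≤ K, m ≤ M → |a m| ≤ ε) :
    |altHalf (fun m => nodeWeight N θ τ m * a m) M| ≤ Real.pi * ε + Real.pi * A / (K + 1)
      + Real.pi * ∑ m ∈ Finset.range M, |a m - a (m + 1)| / (m + 1) := by
  have hpi := Real.pi_pos
  have hm : ∀ m ≤ M, (τ + m) * Real.pi / N ≤ θ := by
    intro m hm
    rw [← hM]
    gcongr
  exact abs_altHalf_mul_le (fun m h => nodeWeight_succ_le hN hθ hτ (hm _ h))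
    (fun m h => nodeWeight_nonneg hN hθ hτ (hm m h))
    (fun m h => nodeWeight_le hN hθ hτ (hm m h)) hA hε0 hε

lemma angle_cases {N : ℕ} (hN : 0 < N) {θ : ℝ} (hθ : θ ∈ Icc 0 Real.pi) :
    (∃ j ≤ N, θ = j * Real.pi / N) ∨
      (θ ∈ Ioo 0 Real.pi ∧ ∃ i : ℕ, ∃ t ∈ Ioo (0 : ℝ) 1, N * θ / Real.pi = i + t ∧
        t = Int.fract (N * θ / Real.pi) ∧ i < N) := by
  have hpi := Real.pi_pos
  have hN' : (0 : ℝ) < N := by exact_mod_cast hN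
  have h0 : 0 ≤ N * θ / Real.pi := by have := hθ.1; positivity
  have hle : N * θ / Real.pi ≤ N := by
    rw [div_le_iff₀ hpi]; exact mul_le_mul_of_nonneg_left hθ.2 hN'.le
  obtain ⟨i, hi⟩ : ∃ i : ℕ, ⌊N * θ / Real.pi⌋ = i :=
    ⟨_, (Int.toNat_of_nonneg (Int.floor_nonneg.2 h0)).symm⟩
  have hsum := Int.floor_add_fract (N * θ / Real.pi)
  rw [hi, Int.cast_natCast] at hsum
  have hi_le : (i : ℝ) ≤ N := by linarith [Int.fract_nonneg (N * θ / Real.pi)]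
  rcases eq_or_ne (Int.fract (N * θ / Real.pi)) 0 with hf | hf
  · left
    refine ⟨i, by exact_mod_cast hi_le, ?_⟩
    rw [hf, add_zero] at hsum
    rw [hsum]
    field_simp
  · right
    have hpos := lt_of_le_of_ne (Int.fract_nonneg (N * θ / Real.pi)) hf.symm
    have hilt : (i : ℝ) < N := by linarith
    refine ⟨⟨lt_of_le_of_ne hθ.1 ?_, lt_of_le_of_ne hθ.2 ?_⟩, i, _,
      ⟨hpos, Int.fract_lt_one _⟩, hsum.symm, rfl, by exact_mod_cast hilt⟩
    · rintro rfl
      simp at hf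
    · rintro rfl
      apply hf
      rw [mul_div_assoc, div_self hpi.ne', mul_one, Int.fract_natCast]

/-- A bounded function whose oscillations along node chains are small is the uniform limit of its
interpolation polynomials on every set at which it is uniformly continuous. -/
lemma tendstoUniformlyOn_lagrangeOp {f : ℝ → ℝ} {W : Set ℝ} (hW : W ⊆ Icc (-1) 1)
    (hbdd : ∃ A, ∀ z ∈ Icc (-1 : ℝ) 1, |f z| ≤ A) (hc : UniformContAt f W)
    (hosc : SmallOscillation f W) :
    TendstoUniformlyOn (fun n => lagrangeOp n f) f atTop W := by
  obtain ⟨A, hA⟩ := hbdd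
  have hpi := Real.pi_pos
  rw [Metric.tendstoUniformlyOn_iff]
  intro ε hε
  set η := ε / (8 * Real.pi) with hη
  have hη0 : 0 < η := by positivity
  obtain ⟨K, hK⟩ := exists_nat_gt (2 * A / η)
  have hA0 : 0 ≤ A := (abs_nonneg _).trans (hA 0 (by norm_num))
  have hK' : 2 * A / (K + 1) ≤ η := by
    rw [div_le_iff₀ (by positivity)]
    rw [div_lt_iff₀ hη0] at hK
    nlinarith
  obtain ⟨δ, hδ, hδf⟩ := hc η hη0
  have hlim : Tendsto (fun N : ℕ => ((K : ℝ) + 1) * (Real.pi / N)) atTop (𝓝 0) := by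
    simpa using (tendsto_const_div_atTop_nhds_zero_nat Real.pi).const_mul ((K : ℝ) + 1)
  have hev : ∀ᶠ N : ℕ in atTop, ∀ x ∈ W, dist (f x) (lagrangeOp (N + 1) f x) < ε := by
    filter_upwards [hlim.eventually (gt_mem_nhds hδ), hosc η hη0, eventually_gt_atTop 0]
      with N hN1 hN2 hN x hx
    have hxI := hW hx
    set θ := Real.arccos x with hθdef
    have hcos : Real.cos θ = x := Real.cos_arccos hxI.1 hxI.2
    rcases angle_cases (θ := θ) hN ⟨Real.arccos_nonneg x, Real.arccos_le_pi x⟩ with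
      ⟨j, hj, hθj⟩ | ⟨hθ, i, t, ht, hit, -, hiN⟩
    · rw [← hcos, hθj, lagrangeOp_eq_self_of_node hN hj, dist_self]
      exact hε
    rw [dist_comm, Real.dist_eq, lagrangeOp_sub_eq hN]
    have hN' : (0 : ℝ) < N := by exact_mod_cast hN
    -- bound for either side, after multiplication of the points by the sign `s`
    have side : ∀ (ϑ τ s : ℝ) (M : ℕ), ϑ ∈ Ioo 0 Real.pi → τ ∈ Ioo (0 : ℝ) 1 →
        (τ + M) * Real.pi / N = ϑ → (s = 1 ∨ s = -1) → s * Real.cos ϑ = x →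
        |altHalf (fun m => nodeWeight N ϑ τ m *
          (f (s * Real.cos (ϑ - (τ + m) * Real.pi / N)) - f x)) M| ≤ 3 * (Real.pi * η) := by
      intro ϑ τ s M hϑ hτ hM hs hsx
      have hch := isNodeChain_cos hN hϑ hτ hM hs
      rw [hsx] at hch
      have h := abs_altHalf_nodeWeight_le (K := K) hN hϑ hτ hM
        (a := fun m => f (s * Real.cos (ϑ - (τ + m) * Real.pi / N)) - f x) (ε := η) (A := 2 * A)
        (fun m hm => ?_) hη0.le (fun m hmK hm => ?_)
      · have h2 := hN2 x hx M _ hch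
        simp only [sub_sub_sub_cancel_right] at h
        have h3 := mul_le_mul_of_nonneg_left h2 hpi.le
        have h4 := mul_le_mul_of_nonneg_left hK' hpi.le
        rw [← mul_div_assoc] at h4
        linarith
      · refine (abs_sub _ _).trans ?_
        linarith [hA _ (hch.mem m hm), hA x hxI]
      · refine hδf x hx _ (hch.mem m hm) ((hch.near m hm).trans_lt (lt_of_le_of_lt ?_ hN1))
        gcongr
    have h1 := side θ t 1 i hθ ht (by rw [add_comm, ← hit]; field_simp) (Or.inl rfl)
      (by rw [one_mul, hcos])
    have h2 := side (Real.pi - θ) (1 - t) (-1) (N - 1 - i)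
      ⟨by linarith [hθ.2], by linarith [hθ.1]⟩ ⟨by linarith [ht.2], by linarith [ht.1]⟩
      (by
        have e : N * θ = (i + t) * Real.pi := by rw [← hit]; field_simp
        rw [Nat.cast_sub (by omega), Nat.cast_sub (by omega)]
        field_simp
        push_cast
        linear_combination e) (Or.inr rfl)
      (by rw [Real.cos_pi_sub, hcos]; ring)
    rw [← hcos, lagrangeOp_cos hN hθ ht hit, hcos]
    simp only [one_mul, neg_one_mul] at h1 h2
    refine (abs_add_le _ _).trans_lt ((add_le_add h1 h2).trans_lt ?_)
    have : Real.pi * η = ε / 8 := by rw [hη]; field_simp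
    rw [this]
    linarith
  obtain ⟨N₀, hN₀⟩ := eventually_atTop.1 hev
  filter_upwards [eventually_ge_atTop (N₀ + 1)] with n hn
  obtain ⟨N, rfl⟩ := Nat.exists_eq_add_of_le' (show 1 ≤ n by omega)
  exact hN₀ N (by omega)

lemma sum_abs_sub_of_monotone {b : ℕ → ℝ} {M : ℕ}
    (hb : (∀ m < M, b m ≤ b (m + 1)) ∨ (∀ m < M, b (m + 1) ≤ b m)) :
    ∑ m ∈ Finset.range M, |b m - b (m + 1)| ≤ |b 0 - b M| := by
  rcases hb with hb | hb
  · have : ∑ m ∈ Finset.range M, |b m - b (m + 1)| = b M - b 0 := by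
      rw [← Finset.sum_range_sub]
      exact Finset.sum_congr rfl fun m hm => by
        rw [abs_sub_comm, abs_of_nonneg (sub_nonneg.2 (hb m (Finset.mem_range.1 hm)))]
    rw [this, abs_sub_comm]
    exact le_abs_self _
  · have : ∑ m ∈ Finset.range M, |b m - b (m + 1)| = b 0 - b M := by
      rw [← Finset.sum_range_sub']
      exact Finset.sum_congr rfl fun m hm => by
        rw [abs_of_nonneg (sub_nonneg.2 (hb m (Finset.mem_range.1 hm)))]
    rw [this]
    exact le_abs_self _

lemma abs_le_of_monotoneOn_or_antitoneOn {f : ℝ → ℝ}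
    (hf : MonotoneOn f (Icc (-1) 1) ∨ AntitoneOn f (Icc (-1) 1)) :
    ∀ z ∈ Icc (-1 : ℝ) 1, |f z| ≤ |f (-1)| + |f 1| := by
  intro z hz
  have h1 : (-1 : ℝ) ∈ Icc (-1 : ℝ) 1 := by norm_num
  have h2 : (1 : ℝ) ∈ Icc (-1 : ℝ) 1 := by norm_num
  rw [abs_le]
  have := neg_abs_le (f (-1))
  have := le_abs_self (f (-1))
  have := neg_abs_le (f 1)
  have := le_abs_self (f 1)
  have := abs_nonneg (f 1)
  have := abs_nonneg (f (-1))
  rcases hf with hf | hf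
  · have := hf h1 hz hz.1
    have := hf hz h2 hz.2
    constructor <;> linarith
  · have := hf h1 hz hz.1
    have := hf hz h2 hz.2
    constructor <;> linarith

/-- For a monotone function the first `K` oscillations are small by continuity, and the others have
weights at most `1 / (K + 1)` and sum at most the total variation. -/
lemma smallOscillation_of_monotoneOn {f : ℝ → ℝ} {W : Set ℝ}
    (hf : MonotoneOn f (Icc (-1) 1) ∨ AntitoneOn f (Icc (-1) 1)) (hc : UniformContAt f W) :
    SmallOscillation f W := by
  intro ε hε
  set A := |f (-1)| + |f 1| with hAdef
  have hA := abs_le_of_monotoneOn_or_antitoneOn hf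
  have hA0 : 0 ≤ A := by positivity
  obtain ⟨K, hK⟩ := exists_nat_gt (4 * A / ε)
  have hK' : 2 * A / (K + 1) ≤ ε / 2 := by
    rw [div_le_iff₀ (by positivity)]
    rw [div_lt_iff₀ hε] at hK
    nlinarith
  set η := ε / (4 * (K + 1)) with hη
  have hη0 : 0 < η := by positivity
  obtain ⟨δ, hδ, hδf⟩ := hc η hη0
  have hlim : Tendsto (fun N : ℕ => ((K : ℝ) + 2) * (Real.pi / N)) atTop (𝓝 0) := by
    simpa using (tendsto_const_div_atTop_nhds_zero_nat Real.pi).const_mul ((K : ℝ) + 2)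
  filter_upwards [hlim.eventually (gt_mem_nhds hδ)] with N hN x hx M P hP
  have hbm : ∑ m ∈ Finset.range M, |f (P m) - f (P (m + 1))| ≤ |f (P 0) - f (P M)| := by
    refine sum_abs_sub_of_monotone (b := fun m => f (P m)) ?_
    have hmem : ∀ m < M, P m ∈ Icc (-1 : ℝ) 1 ∧ P (m + 1) ∈ Icc (-1 : ℝ) 1 :=
      fun m hm => ⟨hP.mem m hm.le, hP.mem _ hm⟩
    rcases hf with hf | hf <;> rcases hP.mono with hm | hm
    · exact Or.inl fun m h => hf (hmem m h).1 (hmem m h).2 (hm m h)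
    · exact Or.inr fun m h => hf (hmem m h).2 (hmem m h).1 (hm m h)
    · exact Or.inr fun m h => hf (hmem m h).1 (hmem m h).2 (hm m h)
    · exact Or.inl fun m h => hf (hmem m h).2 (hmem m h).1 (hm m h)
  have hbm2 : |f (P 0) - f (P M)| ≤ 2 * A := by
    refine (abs_sub _ _).trans ?_
    linarith [hA _ (hP.mem 0 (Nat.zero_le _)), hA _ (hP.mem M le_rfl)]
  have hnear : ∀ m ≤ K + 1, m ≤ M → |f (P m) - f x| ≤ η := by
    intro m hm hmM
    refine hδf x hx _ (hP.mem m hmM) ((hP.near m hmM).trans_lt (lt_of_le_of_lt ?_ hN))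
    have hm' : (m : ℝ) ≤ K + 1 := by exact_mod_cast hm
    have := Real.pi_pos
    exact mul_le_mul_of_nonneg_right (by linarith) (by positivity)
  have hterm : ∀ m ∈ Finset.range M, |f (P m) - f (P (m + 1))| / (m + 1) ≤
      (if m < K + 1 then 2 * η else 0) + |f (P m) - f (P (m + 1))| / (K + 1) := by
    intro m hm
    have hm' := Finset.mem_range.1 hm
    split_ifs with h
    · have h1 := hnear m (by omega) hm'.le
      have h2 := hnear (m + 1) (by omega) hm'
      have h3 : |f (P m) - f (P (m + 1))| ≤ 2 * η := by
        have := abs_sub_le (f (P m)) (f x) (f (P (m + 1)))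
        rw [abs_sub_comm (f x)] at this
        linarith
      have h4 : |f (P m) - f (P (m + 1))| / (m + 1) ≤ |f (P m) - f (P (m + 1))| :=
        div_le_self (abs_nonneg _) (by linarith [m.cast_nonneg (α := ℝ)])
      have h5 : 0 ≤ |f (P m) - f (P (m + 1))| / (K + 1) := by positivity
      linarith
    · rw [zero_add]
      have : (K : ℝ) + 1 ≤ m + 1 := by
        have : K ≤ m := by omega
        gcongr
      gcongr
  refine (Finset.sum_le_sum hterm).trans ?_
  rw [Finset.sum_add_distrib, ← Finset.sum_div, ← Finset.sum_filter, Finset.sum_const]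
  have hcard : ((Finset.range M).filter (· < K + 1)).card ≤ K + 1 := by
    calc _ ≤ (Finset.range (K + 1)).card :=
          Finset.card_le_card fun m hm => by
            simp only [Finset.mem_filter, Finset.mem_range] at hm ⊢; exact hm.2
      _ = K + 1 := Finset.card_range _
  have h1 : ((Finset.range M).filter (· < K + 1)).card • (2 * η) ≤ ε / 2 := by
    rw [nsmul_eq_mul]
    have : (((Finset.range M).filter (· < K + 1)).card : ℝ) ≤ K + 1 := by exact_mod_cast hcard
    calc _ ≤ ((K : ℝ) + 1) * (2 * η) := by gcongr
      _ = ε / 2 := by rw [hη]; field_simp; norm_num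
  have h2 : (∑ m ∈ Finset.range M, |f (P m) - f (P (m + 1))|) / (K + 1) ≤ 2 * A / (K + 1) := by
    gcongr
    exact hbm.trans hbm2
  linarith

lemma le_modulusCont {F : ℝ → ℝ} (hF : ContinuousOn F (Icc (-1) 1)) {x y δ : ℝ}
    (hx : x ∈ Icc (-1 : ℝ) 1) (hy : y ∈ Icc (-1 : ℝ) 1) (h : |x - y| ≤ δ) :
    |F x - F y| ≤ modulusCont F δ := by
  obtain ⟨A, hA⟩ := isCompact_Icc.exists_bound_of_continuousOn hF
  refine le_csSup ⟨A + A, ?_⟩ ⟨x, hx, y, hy, h, rfl⟩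
  rintro r ⟨u, hu, v, hv, -, rfl⟩
  exact (abs_sub _ _).trans (add_le_add (hA u hu) (hA v hv))

/-- For a Dini–Lipschitz function all oscillations are at most `ω(F, π / N)`, and the weights
`1 / (m + 1)` add up to at most `1 + log N`. -/
lemma smallOscillation_of_diniLipschitz {F : ℝ → ℝ} (hF : ContinuousOn F (Icc (-1) 1))
    (hD : DiniLipschitz F) (W : Set ℝ) : SmallOscillation F W := by
  intro ε hε
  have hpi := Real.pi_pos
  have hlim : Tendsto (fun N : ℕ => Real.pi / (N : ℝ)) atTop (𝓝[>] 0) := by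
    refine tendsto_nhdsWithin_iff.2 ⟨tendsto_const_div_atTop_nhds_zero_nat Real.pi, ?_⟩
    filter_upwards [eventually_gt_atTop 0] with N hN
    have hN' : (0 : ℝ) < N := by exact_mod_cast hN
    exact div_pos hpi hN'
  have hlog : Tendsto (fun N : ℕ => Real.log (N : ℝ)) atTop atTop :=
    Real.tendsto_log_atTop.comp tendsto_natCast_atTop_atTop
  have h := hlim.eventually (hD.def (show 0 < ε / 2 by positivity))
  filter_upwards [h, eventually_gt_atTop 0,
    hlog.eventually_ge_atTop (1 + 2 * Real.log Real.pi)] with N hN hN0 hNl x _ M P hP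
  have hN' : (0 : ℝ) < N := by exact_mod_cast hN0
  have hω : modulusCont F (Real.pi / N) ≤ ε / 2 * |Real.log (Real.pi / N)|⁻¹ := by
    refine (le_abs_self _).trans ?_
    simpa using hN
  have hlogpi : 0 < Real.log Real.pi := Real.log_pos (by linarith [Real.pi_gt_three])
  have hlabs : |Real.log (Real.pi / N)| = Real.log N - Real.log Real.pi := by
    rw [Real.log_div hpi.ne' hN'.ne', abs_sub_comm, abs_of_nonneg (by linarith)]
  have hL : 0 < Real.log N - Real.log Real.pi := by linarith
  have hharm : ∑ m ∈ Finset.range M, (1 : ℝ) / (m + 1) ≤ 1 + Real.log N := by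
    calc ∑ m ∈ Finset.range M, (1 : ℝ) / (m + 1)
        ≤ ∑ m ∈ Finset.range N, (1 : ℝ) / (m + 1) :=
          Finset.sum_le_sum_of_subset_of_nonneg (by simpa using hP.len)
            fun m _ _ => by positivity
      _ = (harmonic N : ℝ) := by
          rw [harmonic]; push_cast
          exact Finset.sum_congr rfl fun m _ => one_div _
      _ ≤ 1 + Real.log N := harmonic_le_one_add_log N
  have hterm : ∀ m ∈ Finset.range M, |F (P m) - F (P (m + 1))| / (m + 1) ≤
      ε / 2 * |Real.log (Real.pi / N)|⁻¹ * (1 / (m + 1)) := by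
    intro m hm
    have hm' := Finset.mem_range.1 hm
    rw [div_eq_mul_one_div]
    gcongr
    exact (le_modulusCont hF (hP.mem m hm'.le) (hP.mem _ hm') (hP.step m hm')).trans hω
  refine (Finset.sum_le_sum hterm).trans ?_
  rw [← Finset.mul_sum, hlabs]
  calc ε / 2 * (Real.log N - Real.log Real.pi)⁻¹ * ∑ m ∈ Finset.range M, (1 : ℝ) / (m + 1)
      ≤ ε / 2 * (Real.log N - Real.log Real.pi)⁻¹ * (2 * (Real.log N - Real.log Real.pi)) := by
        gcongr
        linarith
    _ = ε := by field_simp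

lemma uniformContAt_of_continuousOn {F : ℝ → ℝ} (hF : ContinuousOn F (Icc (-1) 1)) :
    UniformContAt F (Icc (-1) 1) := by
  intro ε hε
  have h := isCompact_Icc.uniformContinuousOn_of_continuous hF
  obtain ⟨δ, hδ, h⟩ := Metric.uniformContinuousOn_iff.1 h ε hε
  exact ⟨δ, hδ, fun x hx z hz hzx => (h z hz x hx hzx).le⟩

lemma tendstoUniformlyOn_of_mem_classC {F : ℝ → ℝ} (hF : F ∈ classC) :
    TendstoUniformlyOn (fun n => lagrangeOp n F) F atTop (Icc (-1) 1) := by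
  obtain ⟨hc, h⟩ := hF
  have hu := uniformContAt_of_continuousOn hc
  refine tendstoUniformlyOn_lagrangeOp subset_rfl
    (isCompact_Icc.exists_bound_of_continuousOn hc) hu ?_
  rcases h with h | h | h
  · exact smallOscillation_of_monotoneOn (Or.inl h) hu
  · exact smallOscillation_of_monotoneOn (Or.inr h) hu
  · exact smallOscillation_of_diniLipschitz hc h _

lemma lagrangeOp_add (n : ℕ) (f g : ℝ → ℝ) (x : ℝ) :
    lagrangeOp n (f + g) x = lagrangeOp n f x + lagrangeOp n g x := by
  simp only [lagrangeOp, Pi.add_apply, mul_add, Finset.sum_add_distrib]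

lemma lagrangeOp_smul (n : ℕ) (c : ℝ) (f : ℝ → ℝ) (x : ℝ) :
    lagrangeOp n (c • f) x = c * lagrangeOp n f x := by
  simp only [lagrangeOp, Pi.smul_apply, smul_eq_mul, Finset.mul_sum]
  exact Finset.sum_congr rfl fun k _ => by ring

lemma tendstoUniformlyOn_lagrangeOp_add {f g : ℝ → ℝ} {W : Set ℝ}
    (hf : TendstoUniformlyOn (fun n => lagrangeOp n f) f atTop W)
    (hg : TendstoUniformlyOn (fun n => lagrangeOp n g) g atTop W) :
    TendstoUniformlyOn (fun n => lagrangeOp n (f + g)) (f + g) atTop W := by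
  refine (hf.add hg).congr (Eventually.of_forall fun n x _ => ?_)
  exact (lagrangeOp_add n f g x).symm

lemma tendstoUniformlyOn_lagrangeOp_smul {f : ℝ → ℝ} {W : Set ℝ} (c : ℝ)
    (hf : TendstoUniformlyOn (fun n => lagrangeOp n f) f atTop W) :
    TendstoUniformlyOn (fun n => lagrangeOp n (c • f)) (c • f) atTop W := by
  rw [Metric.tendstoUniformlyOn_iff] at hf ⊢
  intro ε hε
  filter_upwards [hf (ε / (|c| + 1)) (by positivity)] with n hn x hx
  have h := hn x hx
  rw [Real.dist_eq] at h ⊢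
  rw [lagrangeOp_smul, Pi.smul_apply, smul_eq_mul, ← mul_sub, abs_mul]
  rw [lt_div_iff₀ (by positivity)] at h
  nlinarith [abs_nonneg (f x - lagrangeOp n f x), abs_nonneg c]

lemma jumpFun_eq (a d : ℝ) :
    jumpFun a d = (1 - d) • jumpFun a 0 + d • jumpFun a 1 := by
  funext z
  simp only [jumpFun, Pi.add_apply, Pi.smul_apply, smul_eq_mul]
  split_ifs <;> ring

lemma monotone_jumpFun {a d : ℝ} (hd : d ∈ Icc (0 : ℝ) 1) : Monotone (jumpFun a d) := by
  intro u v huv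
  simp only [jumpFun]
  obtain ⟨h0, h1⟩ := hd
  split_ifs <;> first | linarith | (exfalso; grind)

/-- Uniform convergence for jump functions away from the jump: `jumpFun a d` is a linear
combination of the two monotone functions `jumpFun a 0` and `jumpFun a 1`. -/
lemma tendstoUniformlyOn_jumpFun {a ρ : ℝ} (hρ : 0 < ρ) (d : ℝ) {W : Set ℝ}
    (hW : W ⊆ Icc (-1) 1) (hWa : ∀ x ∈ W, ρ ≤ |x - a|) :
    TendstoUniformlyOn (fun n => lagrangeOp n (jumpFun a d)) (jumpFun a d) atTop W := by
  have key : ∀ e ∈ Icc (0 : ℝ) 1,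
      TendstoUniformlyOn (fun n => lagrangeOp n (jumpFun a e)) (jumpFun a e) atTop W := by
    intro e he
    have hm := Or.inl (b := AntitoneOn (jumpFun a e) (Icc (-1) 1))
      ((monotone_jumpFun (a := a) he).monotoneOn (Icc (-1) 1))
    have hc : UniformContAt (jumpFun a e) W := by
      intro ε hε
      refine ⟨ρ, hρ, fun x hx z _ hzx => ?_⟩
      have h1 := hWa x hx
      have : jumpFun a e z = jumpFun a e x := by
        rw [abs_lt] at hzx
        unfold jumpFun
        rcases le_abs.1 h1 with h | h
        · rw [if_neg (by linarith), if_neg (by linarith), if_neg (by linarith),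
            if_neg (by linarith)]
        · rw [if_pos (by linarith), if_pos (by linarith)]
      rw [this, sub_self, abs_zero]
      exact hε.le
    exact tendstoUniformlyOn_lagrangeOp hW ⟨_, abs_le_of_monotoneOn_or_antitoneOn hm⟩ hc
      (smallOscillation_of_monotoneOn hm hc)
  rw [jumpFun_eq a d]
  exact tendstoUniformlyOn_lagrangeOp_add
    (tendstoUniformlyOn_lagrangeOp_smul _ (key 0 (by norm_num)))
    (tendstoUniformlyOn_lagrangeOp_smul _ (key 1 (by norm_num)))

/-! ### The function `g` -/

lemma tendsto_lerchJ_two_mul {a : ℝ} (ha : 0 < a) :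
    Tendsto (fun K : ℕ => ∑ n ∈ Finset.range (2 * K), (-1 : ℝ) ^ n / ((n : ℝ) + a)) atTop
      (𝓝 (lerchJ 1 a)) :=
  (tendsto_lerchJ_one ha).comp
    (tendsto_atTop_mono (fun n => by simp only [id]; omega) tendsto_id :
      Tendsto (fun K : ℕ => 2 * K) atTop atTop)

lemma lerchJ_add_lerchJ_add_one {a : ℝ} (ha : 0 < a) :
    lerchJ 1 a + lerchJ 1 (a + 1) = 1 / a := by
  have h1 := (tendsto_lerchJ_one ha).comp (tendsto_add_atTop_nat 1)
  have h2 := tendsto_lerchJ_one (show 0 < a + 1 by linarith)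
  refine tendsto_nhds_unique (h1.add h2) ?_
  refine tendsto_const_nhds.congr fun N => ?_
  simp only [Function.comp_apply]
  rw [Finset.sum_range_succ', add_assoc, add_comm (_ / _ : ℝ), ← add_assoc,
    ← Finset.sum_add_distrib, Finset.sum_eq_zero]
  · simp
  · intro n _
    rw [pow_succ]
    push_cast
    rw [show (n : ℝ) + 1 + a = n + (a + 1) by ring]
    ring

lemma sum_range_two_mul_lerch (K : ℕ) (a : ℝ) :
    ∑ n ∈ Finset.range (2 * K), (-1 : ℝ) ^ n / ((n : ℝ) + a)
      = ∑ n ∈ Finset.range K, (1 / ((2 * n : ℕ) + a) - 1 / ((2 * n : ℕ) + a + 1)) := by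
  induction K with
  | zero => simp
  | succ K ih =>
    rw [show 2 * (K + 1) = 2 * K + 1 + 1 by ring, Finset.sum_range_succ, Finset.sum_range_succ,
      ih, Finset.sum_range_succ, pow_succ, pow_mul]
    push_cast
    rw [show (2 * K : ℝ) + 1 + a = 2 * K + a + 1 by ring]
    simp
    ring

lemma one_div_sub_one_div_add_one {a : ℝ} (ha : 0 < a) :
    1 / a - 1 / (a + 1) = 1 / (a * (a + 1)) := by
  field_simp
  ring

/-- The difference of two values of `J(1, ·)` is at least that of the first two terms of the
alternating series: the terms taken in pairs are all decreasing functions of `a`. -/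
lemma le_lerchJ_sub {s t : ℝ} (hs : 0 < s) (hst : s ≤ t) :
    1 / (s * (s + 1)) - 1 / (t * (t + 1)) ≤ lerchJ 1 s - lerchJ 1 t := by
  have ht := hs.trans_le hst
  have h := ((tendsto_lerchJ_two_mul hs).sub (tendsto_lerchJ_two_mul ht)).comp
    (tendsto_add_atTop_nat 1)
  refine ge_of_tendsto' h fun K => ?_
  simp only [Function.comp_apply]
  rw [sum_range_two_mul_lerch, sum_range_two_mul_lerch, ← Finset.sum_sub_distrib,
    Finset.sum_range_succ']
  simp only [mul_zero, Nat.cast_zero, zero_add]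
  rw [one_div_sub_one_div_add_one hs, one_div_sub_one_div_add_one ht]
  refine le_add_of_nonneg_left (Finset.sum_nonneg fun n _ => ?_)
  have h0 : (0 : ℝ) ≤ (2 * (n + 1) : ℕ) := Nat.cast_nonneg _
  set c : ℝ := ((2 * (n + 1) : ℕ) : ℝ)
  rw [one_div_sub_one_div_add_one (by linarith), one_div_sub_one_div_add_one (by linarith),
    sub_nonneg]
  gcongr

lemma lerchJ_antitone {s t : ℝ} (hs : 0 < s) (hst : s ≤ t) : lerchJ 1 t ≤ lerchJ 1 s := by
  have h := le_lerchJ_sub hs hst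
  have ht := hs.trans_le hst
  have : 1 / (t * (t + 1)) ≤ 1 / (s * (s + 1)) := by gcongr
  linarith

lemma lerchJ_pos {a : ℝ} (ha : 0 < a) : 0 < lerchJ 1 a := by
  have h1 := lerchJ_add_lerchJ_add_one ha
  have h2 := lerchJ_antitone ha (show a ≤ a + 1 by linarith)
  have h3 : 0 < 1 / a := by positivity
  linarith

lemma lerchJ_sub_le {s t : ℝ} (hs : 0 < s) (hst : s ≤ t) :
    lerchJ 1 s - lerchJ 1 t ≤ 1 / s - 1 / t := by
  have h1 := lerchJ_add_lerchJ_add_one hs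
  have h2 := lerchJ_add_lerchJ_add_one (hs.trans_le hst)
  have h3 := lerchJ_antitone (show 0 < s + 1 by linarith) (show s + 1 ≤ t + 1 by linarith)
  linarith

lemma continuousOn_lerchJ : ContinuousOn (lerchJ 1) (Ioi 0) := by
  intro a ha
  refine ContinuousAt.continuousWithinAt ?_
  have ha' : (0 : ℝ) < a := ha
  have hinv : Tendsto (fun b : ℝ => |1 / b - 1 / a|) (𝓝 a) (𝓝 0) := by
    have : ContinuousAt (fun b : ℝ => |1 / b - 1 / a|) a := by
      have := ha'.ne'
      fun_prop (disch := assumption)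
    simpa [ContinuousAt] using this
  rw [ContinuousAt, tendsto_iff_dist_tendsto_zero]
  refine squeeze_zero' (Eventually.of_forall fun _ => dist_nonneg) ?_ hinv
  filter_upwards [lt_mem_nhds ha'] with b hb
  rw [Real.dist_eq]
  rcases le_total a b with h | h
  · have h1 := lerchJ_antitone ha' h
    have h2 := lerchJ_sub_le ha' h
    rw [abs_sub_comm, abs_of_nonneg (by linarith), abs_sub_comm]
    exact h2.trans (le_abs_self _)
  · have h1 := lerchJ_antitone hb h
    have h2 := lerchJ_sub_le hb h
    rw [abs_of_nonneg (by linarith)]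
    exact h2.trans (le_abs_self _)

lemma abs_lerchJ_sub_sum_le {a : ℝ} (ha : 0 < a) (K : ℕ) :
    |lerchJ 1 a - ∑ n ∈ Finset.range K, (-1 : ℝ) ^ n / ((n : ℝ) + a)| ≤ 1 / (K + a) := by
  have h := (((tendsto_lerchJ_one ha).comp (tendsto_add_atTop_nat K)).sub_const
    (∑ n ∈ Finset.range K, (-1 : ℝ) ^ n / ((n : ℝ) + a))).abs
  refine le_of_tendsto' h fun M => ?_
  simp only [Function.comp_apply]
  rw [add_comm M K, Finset.sum_range_add, add_sub_cancel_left]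
  have hv : Antitone fun m : ℕ => 1 / (((K + m : ℕ) : ℝ) + a) := by
    intro m n hmn
    have : ((K + m : ℕ) : ℝ) ≤ (K + n : ℕ) := by exact_mod_cast Nat.add_le_add_left hmn K
    have : 0 ≤ ((K + m : ℕ) : ℝ) := Nat.cast_nonneg _
    exact one_div_le_one_div_of_le (by linarith) (by linarith)
  have h1 := abs_altSum_le_of_antitone hv (fun m => by positivity) M
  have e : ∑ x ∈ Finset.range M, (-1 : ℝ) ^ (K + x) / (((K + x : ℕ) : ℝ) + a)
      = (-1) ^ K * ∑ m ∈ Finset.range M, (-1 : ℝ) ^ m * (1 / (((K + m : ℕ) : ℝ) + a)) := by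
    rw [Finset.mul_sum]
    exact Finset.sum_congr rfl fun m _ => by rw [pow_add]; ring
  rw [e, abs_mul, abs_pow, abs_neg, abs_one, one_pow, one_mul]
  simpa using h1

/-- The partial fraction expansion of the cotangent, with real partial sums. -/
lemma tendsto_sum_cot {x : ℝ} (hx : ∀ n : ℤ, (n : ℝ) ≠ x) :
    Tendsto (fun N : ℕ => ∑ n ∈ Finset.range N, (1 / (x - (n + 1)) + 1 / (x + (n + 1)))) atTop
      (𝓝 (Real.pi * Real.cot (Real.pi * x) - 1 / x)) := by
  have hz : (x : ℂ) ∈ Complex.integerComplement := by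
    rw [Complex.mem_integerComplement_iff]
    rintro ⟨n, hn⟩
    exact hx n (by exact_mod_cast hn)
  have h := (Complex.continuous_re.tendsto _).comp (tendsto_logDeriv_euler_cot_sub hz)
  convert h using 1
  · funext N
    rw [Function.comp_apply, ← Complex.ofReal_re (∑ n ∈ Finset.range N, _)]
    congr 1
    push_cast
    rfl
  · rw [← Complex.ofReal_re (Real.pi * _ - _)]
    push_cast
    rfl

/-- The reflection formula, from `π / sin (π x) = π cot (π x / 2) - π cot (π x)`. -/
lemma lerchJ_add_lerchJ_one_sub {x : ℝ} (hx : x ∈ Ioo (0 : ℝ) 1) :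
    lerchJ 1 x + lerchJ 1 (1 - x) = Real.pi / Real.sin (Real.pi * x) := by
  obtain ⟨h0, h1⟩ := hx
  have hpi := Real.pi_pos
  have hni : ∀ y ∈ Ioo (0 : ℝ) 1, ∀ n : ℤ, (n : ℝ) ≠ y := by
    rintro y ⟨hy0, hy1⟩ n rfl
    have a1 : 0 < n := by exact_mod_cast hy0
    have a2 : n < 1 := by exact_mod_cast hy1
    omega
  have hA := tendsto_sum_cot (hni x ⟨h0, h1⟩)
  have hB := tendsto_sum_cot (hni (x / 2) ⟨by linarith, by linarith⟩)
  have hA2 := hA.comp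
    (tendsto_atTop_mono (fun n => by simp only [id]; omega) tendsto_id :
      Tendsto (fun K : ℕ => 2 * K) atTop atTop)
  have hJ1 := (tendsto_lerchJ_one h0).comp
    (tendsto_atTop_mono (fun n => by simp only [id]; omega) tendsto_id :
      Tendsto (fun K : ℕ => 2 * K + 1) atTop atTop)
  have hJ2 := tendsto_lerchJ_two_mul (show 0 < 1 - x by linarith)
  have hlim := (hB.sub hA2).const_add (1 / x)
  have hval : 1 / x + (Real.pi * Real.cot (Real.pi * (x / 2)) - 1 / (x / 2)
      - (Real.pi * Real.cot (Real.pi * x) - 1 / x)) = Real.pi / Real.sin (Real.pi * x) := by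
    have hs : 0 < Real.sin (Real.pi * (x / 2)) :=
      Real.sin_pos_of_pos_of_lt_pi (by positivity) (by nlinarith)
    have hc : 0 < Real.cos (Real.pi * (x / 2)) :=
      Real.cos_pos_of_mem_Ioo ⟨by nlinarith, by nlinarith⟩
    rw [Real.cot_eq_cos_div_sin, Real.cot_eq_cos_div_sin,
      show Real.pi * x = 2 * (Real.pi * (x / 2)) by ring, Real.sin_two_mul, Real.cos_two_mul]
    generalize Real.sin (Real.pi * (x / 2)) = S at *
    generalize Real.cos (Real.pi * (x / 2)) = C at *
    field_simp
    ring
  rw [hval] at hlim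
  refine tendsto_nhds_unique (hJ1.add hJ2) (hlim.congr fun N => ?_)
  simp only [Function.comp_apply]
  have hne1 : ∀ n : ℕ, x - (n + 1) ≠ 0 := fun n => by
    have : (0 : ℝ) ≤ n := n.cast_nonneg
    intro h; linarith
  have hne2 : ∀ n : ℕ, x + (n + 1) ≠ 0 := fun n => by
    have : (0 : ℝ) ≤ n := n.cast_nonneg
    intro h; linarith
  induction N with
  | zero => simp
  | succ N ih =>
    rw [Finset.sum_range_succ (n := N), show 2 * (N + 1) = 2 * N + 1 + 1 by ring,
      Finset.sum_range_succ _ (2 * N + 1), Finset.sum_range_succ _ (2 * N),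
      Finset.sum_range_succ _ (2 * N + 1 + 1), Finset.sum_range_succ _ (2 * N + 1),
      Finset.sum_range_succ _ (2 * N + 1), Finset.sum_range_succ _ (2 * N),
      Finset.sum_range_succ _ (2 * N)]
    have e1 : (-1 : ℝ) ^ (2 * N) = 1 := by rw [pow_mul]; simp
    have e2 : (-1 : ℝ) ^ (2 * N + 1) = -1 := by rw [pow_succ, e1]; norm_num
    have e3 : (-1 : ℝ) ^ (2 * N + 1 + 1) = 1 := by rw [pow_succ, e2]; norm_num
    rw [e1, e2, e3]
    rw [Finset.sum_range_succ _ (2 * N), e1] at ih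
    have f1 := hne1 (2 * N)
    have f2 := hne1 (2 * N + 1)
    have f3 := hne2 (2 * N)
    have f4 := hne2 (2 * N + 1)
    push_cast at f1 f2 f3 f4 ih ⊢
    have g1 : 1 / (x / 2 - (N + 1)) = 2 * (1 / (x - (2 * N + 1 + 1))) := by
      rw [show x / 2 - (N + 1) = (x - (2 * N + 1 + 1)) / 2 by ring]
      field_simp
    have g2 : 1 / (x / 2 + (N + 1)) = 2 * (1 / (x + (2 * N + 1 + 1))) := by
      rw [show x / 2 + (N + 1) = (x + (2 * N + 1 + 1)) / 2 by ring]
      field_simp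
    have g3 : 1 / (2 * N + (1 - x)) = - (1 / (x - (2 * N + 1))) := by
      rw [← one_div_neg_eq_neg_one_div]; ring
    have g4 : -1 / (2 * N + 1 + (1 - x)) = 1 / (x - (2 * N + 1 + 1)) := by
      rw [neg_div, ← one_div_neg_eq_neg_one_div]; ring
    have g5 : -1 / (2 * N + 1 + x) = -(1 / (x + (2 * N + 1))) := by
      rw [neg_div]; ring
    have g6 : 1 / (2 * N + 1 + 1 + x) = 1 / (x + (2 * N + 1 + 1)) := by ring
    rw [g1, g2, g3, g4, g5, g6]
    linarith

lemma gFun_one_sub {x : ℝ} (hx : x ∈ Ioo (0 : ℝ) 1) : gFun (1 - x) = 1 - gFun x := by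
  have h := lerchJ_add_lerchJ_one_sub hx
  have hs := sin_pi_mul_pos hx
  have hpi := Real.pi_pos
  unfold gFun
  rw [mul_sub, mul_one, Real.sin_pi_sub, eq_sub_iff_add_eq, ← mul_add, add_comm (lerchJ 1 (1 - x)),
    h]
  field_simp

lemma continuousOn_gFun : ContinuousOn gFun (Ioo 0 1) := by
  unfold gFun
  refine ContinuousOn.mul (by fun_prop) (continuousOn_lerchJ.mono fun x hx => hx.1)

/-- On `[1/2, 1[` both factors of `g` are decreasing; on `[1/2, b]` the second one decreases at a
rate that is bounded below. -/
lemma le_gFun_sub {s t b : ℝ} (hs : 1 / 2 ≤ s) (hst : s ≤ t) (htb : t ≤ b) (hb : b < 1) :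
    Real.sin (Real.pi * b) / (2 * Real.pi) * (t - s) ≤ gFun s - gFun t := by
  have hpi := Real.pi_pos
  have hs0 : 0 < s := by linarith
  have ht0 : 0 < t := by linarith
  have hanti : ∀ u v : ℝ, 1 / 2 ≤ u → u ≤ v → v < 1 →
      Real.sin (Real.pi * v) ≤ Real.sin (Real.pi * u) := by
    intro u v hu huv hv
    rw [← Real.sin_pi_sub (Real.pi * v), ← Real.sin_pi_sub (Real.pi * u)]
    exact Real.sin_le_sin_of_le_of_le_pi_div_two (by nlinarith) (by nlinarith) (by nlinarith)
  have h1 := hanti s t hs hst (by linarith)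
  have h2 := hanti t b (by linarith) htb hb
  have hb0 := sin_pi_mul_pos (τ := b) ⟨by linarith, hb⟩
  have hJ := le_lerchJ_sub hs0 hst
  have hJ2 : (t - s) / 2 ≤ 1 / (s * (s + 1)) - 1 / (t * (t + 1)) := by
    have e : 1 / (s * (s + 1)) - 1 / (t * (t + 1))
        = (t - s) * ((t + s + 1) / (s * (s + 1) * (t * (t + 1)))) := by
      field_simp
      ring
    rw [e, div_eq_mul_one_div]
    refine mul_le_mul_of_nonneg_left ?_ (by linarith)
    rw [div_le_div_iff₀ (by norm_num) (by positivity)]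
    have a1 : s * (s + 1) ≤ 2 := by nlinarith
    have a2 : t * (t + 1) ≤ 2 := by nlinarith
    have a3 : s * (s + 1) * (t * (t + 1)) ≤ 2 * 2 := by gcongr
    linarith
  have h3 : Real.sin (Real.pi * b) * ((t - s) / 2)
      ≤ Real.sin (Real.pi * t) * (lerchJ 1 s - lerchJ 1 t) :=
    mul_le_mul h2 (hJ2.trans hJ) (by linarith) (hb0.le.trans h2)
  have h4 : 0 ≤ (Real.sin (Real.pi * s) - Real.sin (Real.pi * t)) * lerchJ 1 s :=
    mul_nonneg (by linarith) (lerchJ_pos hs0).le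
  unfold gFun
  have e1 : Real.sin (Real.pi * b) / (2 * Real.pi) * (t - s)
      = Real.sin (Real.pi * b) * ((t - s) / 2) / Real.pi := by field_simp
  have e2 : Real.sin (Real.pi * s) / Real.pi * lerchJ 1 s
      - Real.sin (Real.pi * t) / Real.pi * lerchJ 1 t
      = ((Real.sin (Real.pi * s) - Real.sin (Real.pi * t)) * lerchJ 1 s
        + Real.sin (Real.pi * t) * (lerchJ 1 s - lerchJ 1 t)) / Real.pi := by ring
  rw [e1, e2]
  gcongr
  linarith

lemma strictAntiOn_gFun : StrictAntiOn gFun (Ioo 0 1) := by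
  have h1 : StrictAntiOn gFun (Ico (1 / 2) 1) := by
    intro s hs t ht hst
    have h := le_gFun_sub hs.1 hst.le le_rfl ht.2
    have hpos := sin_pi_mul_pos (τ := t) ⟨by linarith [ht.1], ht.2⟩
    have : 0 < Real.sin (Real.pi * t) / (2 * Real.pi) * (t - s) :=
      mul_pos (div_pos hpos (by positivity)) (by linarith)
    linarith
  have h2 : StrictAntiOn gFun (Ioc 0 (1 / 2)) := by
    intro s hs t ht hst
    have h := h1 (a := 1 - t) ⟨by linarith [ht.2], by linarith [ht.1]⟩ (b := 1 - s)
      ⟨by linarith [hs.2], by linarith [hs.1]⟩ (by linarith)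
    rw [gFun_one_sub ⟨hs.1, by linarith [hs.2]⟩, gFun_one_sub ⟨ht.1, by linarith [ht.2]⟩] at h
    linarith
  rw [← Ioc_union_Ico_eq_Ioo (show (0 : ℝ) < 1 / 2 by norm_num) (show (1 / 2 : ℝ) < 1 by norm_num)]
  exact h2.union h1 (isGreatest_Ioc (by norm_num)) (isLeast_Ico (by norm_num))

/-- A function which expands distances on `S` by a factor at least `c > 0` pulls null sets back to
null sets. -/
lemma volume_inter_preimage_eq_zero {φ : ℝ → ℝ} {S Z : Set ℝ} {c : ℝ} (hc : 0 < c)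
    (h : ∀ s ∈ S, ∀ t ∈ S, s ≤ t → c * (t - s) ≤ φ s - φ t) (hZ : volume Z = 0) :
    volume {t | t ∈ S ∧ φ t ∈ Z} = 0 := by
  set E := {t | t ∈ S ∧ φ t ∈ Z} with hE
  have h' : ∀ s ∈ S, ∀ t ∈ S, |t - s| ≤ c⁻¹ * |φ t - φ s| := by
    intro s hs t ht
    rw [inv_mul_eq_div, le_div_iff₀ hc]
    rcases le_total s t with hst | hst
    · have := h s hs t ht hst
      rw [abs_of_nonneg (by linarith), abs_sub_comm]
      linarith [le_abs_self (φ s - φ t)]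
    · have := h t ht s hs hst
      rw [abs_sub_comm, abs_of_nonneg (by linarith)]
      linarith [le_abs_self (φ t - φ s)]
  have hinj : InjOn φ E := by
    intro s hs t ht hst
    have := h' s hs.1 t ht.1
    rw [hst, sub_self, abs_zero, mul_zero] at this
    have := abs_nonpos_iff.1 this
    linarith
  have hlip : LipschitzOnWith ⟨c⁻¹, by positivity⟩ (Function.invFunOn φ E) (φ '' E) := by
    refine LipschitzOnWith.of_dist_le_mul ?_
    rintro _ ⟨s, hs, rfl⟩ _ ⟨t, ht, rfl⟩
    rw [hinj.leftInvOn_invFunOn hs, hinj.leftInvOn_invFunOn ht, Real.dist_eq, Real.dist_eq]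
    exact h' t ht.1 s hs.1
  have himg : Function.invFunOn φ E '' (φ '' E) = E := hinj.leftInvOn_invFunOn.image_image
  have hm := hlip.hausdorffMeasure_image_le (d := 1) zero_le_one
  rw [himg, hausdorffMeasure_real] at hm
  have h0 : volume (φ '' E) = 0 := measure_mono_null (by rintro _ ⟨s, hs, rfl⟩; exact hs.2) hZ
  rw [h0, mul_zero] at hm
  exact nonpos_iff_eq_zero.1 hm

/-- `g` pulls null sets back to null sets. -/
lemma volume_gFun_preimage_eq_zero {Z : Set ℝ} (hZ : volume Z = 0) :
    volume {t | t ∈ Ioo (0 : ℝ) 1 ∧ gFun t ∈ Z} = 0 := by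
  have key : ∀ Z : Set ℝ, volume Z = 0 → volume {t | t ∈ Ico (1 / 2 : ℝ) 1 ∧ gFun t ∈ Z} = 0 := by
    intro Z hZ
    have hk : ∀ k : ℕ, volume {t | t ∈ Icc (1 / 2 : ℝ) (1 - 1 / (k + 2)) ∧ gFun t ∈ Z} = 0 := by
      intro k
      have hk0 : (0 : ℝ) < 1 / (k + 2) := by positivity
      have hk1 : (1 : ℝ) / (k + 2) < 1 := by
        rw [div_lt_one (by positivity)]
        linarith [k.cast_nonneg (α := ℝ)]
      refine volume_inter_preimage_eq_zero
        (c := Real.sin (Real.pi * (1 - 1 / (k + 2))) / (2 * Real.pi)) ?_ ?_ hZ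
      · exact div_pos (sin_pi_mul_pos ⟨by linarith, by linarith⟩) (by positivity)
      · intro s hs t ht hst
        exact le_gFun_sub hs.1 hst ht.2 (by linarith)
    refine measure_mono_null ?_ (measure_iUnion_null hk)
    rintro t ⟨ht, htZ⟩
    obtain ⟨k, hk⟩ := exists_nat_one_div_lt (show 0 < 1 - t by linarith [ht.2])
    refine mem_iUnion.2 ⟨k, ⟨ht.1, ?_⟩, htZ⟩
    have : (1 : ℝ) / (k + 2) ≤ 1 / (k + 1) := by gcongr; norm_num
    linarith
  have hrefl : MeasurePreserving (fun t : ℝ => 1 - t) volume volume :=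
    Measure.measurePreserving_sub_left volume 1
  have hZ' : volume {z | 1 - z ∈ Z} = 0 := by
    exact hrefl.quasiMeasurePreserving.preimage_null hZ
  have h2 := hrefl.quasiMeasurePreserving.preimage_null (key _ hZ')
  refine measure_mono_null ?_ (measure_union_null (key Z hZ) h2)
  rintro t ⟨ht, htZ⟩
  rcases le_total (1 / 2) t with h | h
  · exact Or.inl ⟨⟨h, ht.2⟩, htZ⟩
  · right
    refine ⟨⟨by linarith, by linarith [ht.1]⟩, ?_⟩
    rw [mem_ofPred_eq, gFun_one_sub ht, sub_sub_cancel]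
    exact htZ

/-! ### The Lagrange operator at a jump -/

lemma abs_cos_sub_cos_sub_le {θ δ : ℝ} (hθ : θ ∈ Ioo 0 Real.pi) (hδ : δ ∈ Icc 0 θ) :
    |Real.cos (θ - δ) - Real.cos θ - Real.sin θ * δ| ≤ 2 * δ ^ 2 := by
  have h1 := Real.one_sub_sq_div_two_le_cos (x := δ)
  have h2 := Real.sin_ge_sub_cube hδ.1
  have h3 := Real.sin_le hδ.1
  have h4 : δ ^ 3 / 6 ≤ δ ^ 2 := by
    have : δ ≤ 6 := by linarith [hδ.2, hθ.2, Real.pi_le_four]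
    nlinarith [sq_nonneg δ]
  have e : Real.cos (θ - δ) - Real.cos θ - Real.sin θ * δ
      = Real.cos θ * (Real.cos δ - 1) + Real.sin θ * (Real.sin δ - δ) := by
    rw [Real.cos_sub]; ring
  have h5 : |Real.cos δ - 1| ≤ δ ^ 2 := by
    rw [abs_le]; constructor <;> nlinarith [Real.cos_le_one δ]
  have h6 : |Real.sin δ - δ| ≤ δ ^ 2 := by
    rw [abs_le]; constructor <;> nlinarith [sq_nonneg δ]
  rw [e]
  refine (abs_add_le _ _).trans ?_
  rw [abs_mul, abs_mul]
  have h7 := mul_le_mul (Real.abs_cos_le_one θ) h5 (abs_nonneg _) zero_le_one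
  have h8 := mul_le_mul (Real.abs_sin_le_one θ) h6 (abs_nonneg _) zero_le_one
  linarith

lemma abs_nodeWeight_sub_le {N m : ℕ} {θ τ : ℝ} (hN : 0 < N) (hθ : θ ∈ Ioo 0 Real.pi)
    (hτ : τ ∈ Ioo (0 : ℝ) 1) (hm : (τ + m) * Real.pi / N ≤ θ) :
    |nodeWeight N θ τ m - Real.sin (Real.pi * τ) / Real.pi * (1 / (m + τ))|
      ≤ 2 * Real.pi / Real.sin θ / N := by
  have hpi := Real.pi_pos
  have hN' : (0 : ℝ) < N := by exact_mod_cast hN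
  have hδ := angle_step_pos hN hτ m
  have hlow := sin_mul_le_cos_sub_cos hθ ⟨hδ.le, hm⟩
  have happ := abs_cos_sub_cos_sub_le hθ ⟨hδ.le, hm⟩
  have hD := cos_sub_cos_pos hN hθ hτ hm
  have hs := Real.sin_pos_of_pos_of_lt_pi hθ.1 hθ.2
  have hS := sin_pi_mul_pos hτ
  have hτm : (0 : ℝ) < m + τ := by have := hτ.1; positivity
  unfold nodeWeight
  have hδe : (m + τ : ℝ) = (τ + m) * Real.pi / N * N / Real.pi := by field_simp; ring
  rw [hδe]
  set δ := (τ + m) * Real.pi / N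
  set D := Real.cos (θ - δ) - Real.cos θ
  have e : Real.sin θ * Real.sin (Real.pi * τ) / (N * D)
      - Real.sin (Real.pi * τ) / Real.pi * (1 / (δ * N / Real.pi))
      = -(Real.sin (Real.pi * τ) / (N * (D * δ)) * (D - Real.sin θ * δ)) := by
    field_simp
    ring
  rw [e, abs_neg, abs_mul, abs_of_pos (by positivity)]
  have h1 : Real.sin (Real.pi * τ) / (N * (D * δ)) ≤ 1 / (N * (Real.sin θ * (δ / Real.pi) * δ)) := by
    gcongr
    exact Real.sin_le_one _
  calc _ ≤ 1 / (N * (Real.sin θ * (δ / Real.pi) * δ)) * (2 * δ ^ 2) := by gcongr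
    _ = _ := by field_simp

/-- At the jump the operator sees the alternating sum of the weights on one side, each of which is
asymptotic to the corresponding term of the series defining `g`; the alternating tails are
uniformly small. -/
lemma tendsto_lagrangeOp_jumpFun_sub {θ : ℝ} (hθ : θ ∈ Ioo 0 Real.pi) (d : ℝ) :
    Tendsto (fun N : ℕ => lagrangeOp (N + 1) (jumpFun (Real.cos θ) d) (Real.cos θ) -
      (if Int.fract (N * θ / Real.pi) = 0 then d else gFun (Int.fract (N * θ / Real.pi))))
      atTop (𝓝 0) := by
  have hpi := Real.pi_pos
  have hs := Real.sin_pos_of_pos_of_lt_pi hθ.1 hθ.2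
  rw [Metric.tendsto_atTop']
  intro ε hε
  obtain ⟨K, hK⟩ := exists_nat_gt ((Real.pi + 1) / (ε / 2))
  have hK' : Real.pi / (K + 1) + 1 / (K + 1) < ε / 2 := by
    rw [← add_div, div_lt_iff₀ (by positivity)]
    rw [div_lt_iff₀ (by positivity)] at hK
    nlinarith
  have hlim1 : Tendsto (fun N : ℕ => (K : ℝ) * (2 * Real.pi / Real.sin θ / N)) atTop (𝓝 0) := by
    simpa using (tendsto_const_div_atTop_nhds_zero_nat (2 * Real.pi / Real.sin θ)).const_mul (K : ℝ)
  have hlim2 : Tendsto (fun N : ℕ => (N : ℝ) * (θ / Real.pi)) atTop atTop :=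
    tendsto_natCast_atTop_atTop.atTop_mul_const (div_pos hθ.1 hpi)
  obtain ⟨N₀, hN₀⟩ := eventually_atTop.1 ((hlim1.eventually (gt_mem_nhds (half_pos hε))).and
    ((hlim2.eventually_ge_atTop (K + 1)).and (eventually_gt_atTop 0)))
  refine ⟨N₀, fun N hN => ?_⟩
  obtain ⟨hN1, hN2, hN0⟩ := hN₀ N hN.le
  have hN' : (0 : ℝ) < N := by exact_mod_cast hN0
  rw [dist_zero_right, Real.norm_eq_abs]
  rcases angle_cases hN0 (Ioo_subset_Icc_self hθ) with ⟨j, hj, hθj⟩ | ⟨-, i, t, ht, hit, htf, hiN⟩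
  · have hf : Int.fract (N * θ / Real.pi) = 0 := by
      have : N * θ / Real.pi = j := by rw [hθj]; field_simp
      rw [this, Int.fract_natCast]
    rw [if_pos hf]
    have h1 : lagrangeOp (N + 1) (jumpFun (Real.cos θ) d) (Real.cos θ)
        = jumpFun (Real.cos θ) d (Real.cos θ) := by
      have := lagrangeOp_eq_self_of_node hN0 hj (jumpFun (Real.cos θ) d)
      rwa [← hθj] at this
    have h2 : jumpFun (Real.cos θ) d (Real.cos θ) = d := by simp [jumpFun]
    rw [h1, h2, sub_self, abs_zero]
    exact hε
  rw [← htf, if_neg ht.1.ne']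
  have hθi : (t + i) * Real.pi / N = θ := by rw [add_comm, ← hit]; field_simp
  have hm : ∀ m ≤ i, (t + m) * Real.pi / N ≤ θ := by
    intro m hm
    rw [← hθi]
    gcongr
  have hKi : K ≤ i := by
    have : (K : ℝ) + 1 ≤ i + t := by rw [← hit, mul_div_assoc]; exact hN2
    have h2 : (K : ℝ) < i := by linarith [ht.2]
    exact_mod_cast h2.le
  have hL : lagrangeOp (N + 1) (jumpFun (Real.cos θ) d) (Real.cos θ)
      = altHalf (nodeWeight N θ t) i := by
    rw [lagrangeOp_cos hN0 hθ ht hit]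
    have hleft : altHalf (fun m => nodeWeight N θ t m *
        jumpFun (Real.cos θ) d (Real.cos (θ - (t + m) * Real.pi / N))) i
        = altHalf (nodeWeight N θ t) i := by
      refine altHalf_congr fun m hmi => ?_
      have := cos_sub_cos_pos hN0 hθ ht (hm m hmi)
      rw [jumpFun, if_neg (by linarith), if_neg (by linarith), mul_one]
    have hright : altHalf (fun m => nodeWeight N (Real.pi - θ) (1 - t) m *
        jumpFun (Real.cos θ) d (-Real.cos (Real.pi - θ - (1 - t + m) * Real.pi / N))) (N - 1 - i)
        = altHalf (fun _ => 0) (N - 1 - i) := by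
      refine altHalf_congr fun m hmi => ?_
      have hmi' : (m : ℝ) + 1 + i ≤ N := by
        have : m + 1 + i ≤ N := by omega
        exact_mod_cast this
      have hle : (1 - t + m) * Real.pi / N ≤ Real.pi - θ := by
        rw [← hθi, div_le_iff₀ hN', sub_mul, div_mul_cancel₀ _ hN'.ne']
        nlinarith
      have := cos_sub_cos_pos hN0 (θ := Real.pi - θ) ⟨by linarith [hθ.2], by linarith [hθ.1]⟩
        (τ := 1 - t) ⟨by linarith [ht.2], by linarith [ht.1]⟩ hle
      rw [Real.cos_pi_sub] at this
      rw [jumpFun, if_pos (by linarith), mul_zero]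
    rw [hleft, hright]
    simp [altHalf]
  obtain ⟨M, rfl⟩ := Nat.exists_eq_add_of_le hKi
  set S := Real.sin (Real.pi * t) / Real.pi with hS
  have hS0 : 0 < S := div_pos (sin_pi_mul_pos ht) hpi
  set w := nodeWeight N θ t
  have htail : |altHalf (fun m => w (K + m)) M| ≤ Real.pi / (K + 1) := by
    refine (abs_altHalf_le_of_antitone (fun m hmM => ?_) ?_).trans ?_
    · exact nodeWeight_succ_le hN0 hθ ht (hm (K + m + 1) (by omega))
    · exact nodeWeight_nonneg hN0 hθ ht (hm _ le_rfl)
    · exact nodeWeight_le hN0 hθ ht (hm _ hKi)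
  have hJ := abs_lerchJ_sub_sum_le ht.1 K
  have hSJ : |S * ∑ n ∈ Finset.range K, (-1 : ℝ) ^ n / ((n : ℝ) + t) - gFun t| ≤ 1 / (K + 1) := by
    unfold gFun
    rw [← hS, ← mul_sub, abs_mul, abs_of_pos hS0, abs_sub_comm]
    refine (mul_le_mul_of_nonneg_left hJ hS0.le).trans ?_
    have h := sin_pi_mul_div_le ht K
    calc S * (1 / (K + t)) = Real.sin (Real.pi * t) / (t + K) / Real.pi := by
          rw [hS, add_comm t]; field_simp
      _ ≤ Real.pi / (K + 1) / Real.pi := by gcongr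
      _ = 1 / (K + 1) := by field_simp
  have hmid : |∑ m ∈ Finset.range K, (-1 : ℝ) ^ m * w m
      - S * ∑ n ∈ Finset.range K, (-1 : ℝ) ^ n / ((n : ℝ) + t)|
      ≤ K * (2 * Real.pi / Real.sin θ / N) := by
    rw [Finset.mul_sum, ← Finset.sum_sub_distrib]
    refine (Finset.abs_sum_le_sum_abs _ _).trans ?_
    refine (Finset.sum_le_card_nsmul _ _ (2 * Real.pi / Real.sin θ / N) fun m hmK => ?_).trans ?_
    · have h := abs_nodeWeight_sub_le hN0 hθ ht
        (hm m (by have := Finset.mem_range.1 hmK; omega))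
      have e : (-1 : ℝ) ^ m * w m - S * ((-1) ^ m / (m + t))
          = (-1) ^ m * (w m - S * (1 / (m + t))) := by ring
      rw [e, abs_mul, abs_pow, abs_neg, abs_one, one_pow, one_mul]
      exact h
    · simp
  rw [hL, altHalf_add]
  have e : ∑ m ∈ Finset.range K, (-1 : ℝ) ^ m * w m
      + (-1) ^ K * altHalf (fun m => w (K + m)) M - gFun t
      = (∑ m ∈ Finset.range K, (-1 : ℝ) ^ m * w m
        - S * ∑ n ∈ Finset.range K, (-1 : ℝ) ^ n / ((n : ℝ) + t))
        + (-1) ^ K * altHalf (fun m => w (K + m)) M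
        + (S * ∑ n ∈ Finset.range K, (-1 : ℝ) ^ n / ((n : ℝ) + t) - gFun t) := by ring
  rw [e]
  refine (abs_add_three _ _ _).trans_lt ?_
  rw [abs_mul, abs_pow, abs_neg, abs_one, one_pow, one_mul]
  linarith

/-! ### Local structure of the functions of the class `𝒞 + H` -/

/-- `u` is continuous at `y` and the uniform limit of its interpolation polynomials near `y`. -/
def IsRegularAt (u : ℝ → ℝ) (y : ℝ) : Prop :=
  ContinuousAt u y ∧ ∃ W ∈ 𝓝 y, TendstoUniformlyOn (fun n => lagrangeOp n u) u atTop W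

lemma IsRegularAt.add {u v : ℝ → ℝ} {y : ℝ} (hu : IsRegularAt u y) (hv : IsRegularAt v y) :
    IsRegularAt (u + v) y := by
  obtain ⟨hu, W, hW, hWu⟩ := hu
  obtain ⟨hv, V, hV, hVv⟩ := hv
  exact ⟨hu.add hv, W ∩ V, inter_mem hW hV,
    tendstoUniformlyOn_lagrangeOp_add (hWu.mono inter_subset_left) (hVv.mono inter_subset_right)⟩

lemma IsRegularAt.smul {u : ℝ → ℝ} {y : ℝ} (c : ℝ) (hu : IsRegularAt u y) :
    IsRegularAt (c • u) y := by
  obtain ⟨hu, W, hW, hWu⟩ := hu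
  exact ⟨hu.const_smul c, W, hW, tendstoUniformlyOn_lagrangeOp_smul c hWu⟩

lemma isRegularAt_of_mem_classC {F : ℝ → ℝ} (hF : F ∈ classC) {y : ℝ}
    (hy : y ∈ Ioo (-1 : ℝ) 1) : IsRegularAt F y :=
  ⟨hF.1.continuousAt (Icc_mem_nhds hy.1 hy.2), _, Icc_mem_nhds hy.1 hy.2,
    tendstoUniformlyOn_of_mem_classC hF⟩

lemma eventuallyEq_jumpFun_left (y d : ℝ) : jumpFun y d =ᶠ[𝓝[<] y] fun _ => 0 := by
  filter_upwards [self_mem_nhdsWithin] with z hz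
  exact if_pos hz

lemma eventuallyEq_jumpFun_right (y d : ℝ) : jumpFun y d =ᶠ[𝓝[>] y] fun _ => 1 := by
  filter_upwards [self_mem_nhdsWithin] with z hz
  have hz' : y < z := hz
  rw [jumpFun, if_neg (by linarith), if_neg (by linarith)]

lemma isRegularAt_jumpFun {a y : ℝ} (hy : y ∈ Ioo (-1 : ℝ) 1) (hay : a ≠ y) (d : ℝ) :
    IsRegularAt (jumpFun a d) y := by
  constructor
  · rcases lt_or_gt_of_ne hay with h | h
    · refine ContinuousAt.congr (f := fun _ => 1) continuousAt_const ?_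
      filter_upwards [lt_mem_nhds h] with z hz
      rw [jumpFun, if_neg (by linarith), if_neg (by linarith)]
    · refine ContinuousAt.congr (f := fun _ => 0) continuousAt_const ?_
      filter_upwards [gt_mem_nhds h] with z hz
      rw [jumpFun, if_pos hz]
  · have hρ : 0 < |y - a| / 2 := half_pos (abs_pos.2 (sub_ne_zero.2 hay.symm))
    refine ⟨Icc (-1) 1 ∩ Metric.ball y (|y - a| / 2),
      inter_mem (Icc_mem_nhds hy.1 hy.2) (Metric.ball_mem_nhds y hρ),
      tendstoUniformlyOn_jumpFun hρ d inter_subset_left fun x hx => ?_⟩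
    have h1 : |x - y| < |y - a| / 2 := hx.2
    have h2 := abs_sub_le y x a
    rw [abs_sub_comm y x] at h2
    linarith

/-- Up to a function which is regular at `y`, every element of `H` is near `y` a combination of
two jump functions at `y`. -/
lemma exists_decomposition_of_mem_spaceH {h : ℝ → ℝ} (hh : h ∈ spaceH) {y : ℝ}
    (hy : y ∈ Ioo (-1 : ℝ) 1) :
    ∃ u, ∃ a b : ℝ, IsRegularAt u y ∧ h = u + a • jumpFun y 0 + b • jumpFun y 1 := by
  have hzero : IsRegularAt 0 y := by
    refine isRegularAt_of_mem_classC ⟨continuousOn_const, Or.inl ?_⟩ hy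
    exact monotoneOn_const
  unfold spaceH at hh
  induction hh using Submodule.span_induction with
  | mem h hmem =>
    obtain ⟨x₀, -, d, rfl⟩ := hmem
    by_cases hxy : x₀ = y
    · subst hxy
      refine ⟨0, 1 - d, d, hzero, ?_⟩
      rw [zero_add]
      exact jumpFun_eq x₀ d
    · exact ⟨jumpFun x₀ d, 0, 0, isRegularAt_jumpFun hy hxy d, by simp⟩
  | zero => exact ⟨0, 0, 0, hzero, by simp⟩
  | add h₁ h₂ _ _ ih₁ ih₂ =>
    obtain ⟨u₁, a₁, b₁, hu₁, rfl⟩ := ih₁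
    obtain ⟨u₂, a₂, b₂, hu₂, rfl⟩ := ih₂
    exact ⟨u₁ + u₂, a₁ + a₂, b₁ + b₂, hu₁.add hu₂, by module⟩
  | smul c h _ ih =>
    obtain ⟨u, a, b, hu, rfl⟩ := ih
    exact ⟨c • u, c * a, c * b, hu.smul c, by module⟩

lemma exists_decomposition_of_mem_classCH {f : ℝ → ℝ} (hf : f ∈ classCH) {y : ℝ}
    (hy : y ∈ Ioo (-1 : ℝ) 1) :
    ∃ u, ∃ a b : ℝ, IsRegularAt u y ∧
      EqOn f (u + a • jumpFun y 0 + b • jumpFun y 1) (Icc (-1) 1) := by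
  obtain ⟨F, hF, h, hh, hfe⟩ := hf
  obtain ⟨u, a, b, hu, rfl⟩ := exists_decomposition_of_mem_spaceH hh hy
  refine ⟨F + u, a, b, (isRegularAt_of_mem_classC hF hy).add hu, ?_⟩
  rw [add_assoc, add_assoc, ← add_assoc u]
  exact hfe

lemma lagrangeOp_congr {f g : ℝ → ℝ} (h : EqOn f g (Icc (-1) 1)) (n : ℕ) :
    lagrangeOp n f = lagrangeOp n g := by
  funext x
  unfold lagrangeOp
  exact Finset.sum_congr rfl fun k _ => by rw [h (chebNode_mem_Icc n k)]

lemma tendsto_left_of_eqOn {f u : ℝ → ℝ} {y a b : ℝ} (hy : y ∈ Ioo (-1 : ℝ) 1)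
    (hu : ContinuousAt u y)
    (hfe : EqOn f (u + a • jumpFun y 0 + b • jumpFun y 1) (Icc (-1) 1)) :
    Tendsto f (𝓝[<] y) (𝓝 (u y)) := by
  refine (hu.tendsto.mono_left nhdsWithin_le_nhds).congr' ?_
  filter_upwards [eventuallyEq_jumpFun_left y 0, eventuallyEq_jumpFun_left y 1,
    mem_nhdsWithin_of_mem_nhds (Icc_mem_nhds hy.1 hy.2)] with z h0 h1 hz
  rw [hfe hz]
  simp [h0, h1]

lemma tendsto_right_of_eqOn {f u : ℝ → ℝ} {y a b : ℝ} (hy : y ∈ Ioo (-1 : ℝ) 1)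
    (hu : ContinuousAt u y)
    (hfe : EqOn f (u + a • jumpFun y 0 + b • jumpFun y 1) (Icc (-1) 1)) :
    Tendsto f (𝓝[>] y) (𝓝 (u y + a + b)) := by
  refine (((hu.tendsto.mono_left nhdsWithin_le_nhds).add_const a).add_const b).congr' ?_
  filter_upwards [eventuallyEq_jumpFun_right y 0, eventuallyEq_jumpFun_right y 1,
    mem_nhdsWithin_of_mem_nhds (Icc_mem_nhds hy.1 hy.2)] with z h0 h1 hz
  rw [hfe hz]
  simp [h0, h1]

lemma eq_of_eqOn {f u : ℝ → ℝ} {y a b : ℝ} (hy : y ∈ Ioo (-1 : ℝ) 1)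
    (hfe : EqOn f (u + a • jumpFun y 0 + b • jumpFun y 1) (Icc (-1) 1)) :
    f y = u y + b := by
  rw [hfe (Ioo_subset_Icc_self hy)]
  simp [jumpFun]

/-- The interpolation polynomials converge uniformly on compact sets of continuity points. -/
lemma tendstoUniformlyOn_of_mem_classCH {f : ℝ → ℝ} (hf : f ∈ classCH) {K : Set ℝ}
    (hK : IsCompact K) (hKI : K ⊆ Ioo (-1) 1) (hKc : ∀ y ∈ K, ContinuousAt f y) :
    TendstoUniformlyOn (fun n => lagrangeOp n f) f atTop K := by
  rw [← tendstoLocallyUniformlyOn_iff_tendstoUniformlyOn_of_compact hK]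
  intro V hV y hyK
  have hy := hKI hyK
  obtain ⟨u, a, b, ⟨huc, W, hW, hWu⟩, hfe⟩ := exists_decomposition_of_mem_classCH hf hy
  have hc := (hKc y hyK).tendsto
  have h1 := tendsto_nhds_unique (hc.mono_left nhdsWithin_le_nhds) (tendsto_left_of_eqOn hy huc hfe)
  have h2 := tendsto_nhds_unique (hc.mono_left nhdsWithin_le_nhds)
    (tendsto_right_of_eqOn hy huc hfe)
  have h3 := eq_of_eqOn hy hfe
  have hb : b = 0 := by linarith
  have ha : a = 0 := by linarith
  subst ha hb
  simp only [zero_smul, add_zero] at hfe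
  refine ⟨W ∩ Icc (-1) 1, mem_nhdsWithin_of_mem_nhds (inter_mem hW (Icc_mem_nhds hy.1 hy.2)), ?_⟩
  filter_upwards [hWu V hV] with n hn x hx
  rw [lagrangeOp_congr hfe n, hfe hx.2]
  exact hn x hx.1

/-- The behaviour of the interpolation polynomials at an arbitrary interior point. -/
lemma tendsto_lagrangeOp_sub {f : ℝ → ℝ} (hf : f ∈ classCH) {θ l r : ℝ}
    (hθ : θ ∈ Ioo 0 Real.pi) (hl : Tendsto f (𝓝[<] (Real.cos θ)) (𝓝 l))
    (hr : Tendsto f (𝓝[>] (Real.cos θ)) (𝓝 r)) :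
    Tendsto (fun N : ℕ => lagrangeOp (N + 1) f (Real.cos θ) -
      (if Int.fract (N * θ / Real.pi) = 0 then f (Real.cos θ)
        else l + (r - l) * gFun (Int.fract (N * θ / Real.pi)))) atTop (𝓝 0) := by
  have hy : Real.cos θ ∈ Ioo (-1 : ℝ) 1 := by
    have hpi := Real.pi_pos
    constructor
    · rw [← Real.cos_pi]
      exact Real.cos_lt_cos_of_nonneg_of_le_pi hθ.1.le le_rfl hθ.2
    · rw [← Real.cos_zero]
      exact Real.cos_lt_cos_of_nonneg_of_le_pi le_rfl hθ.2.le hθ.1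
  obtain ⟨u, a, b, ⟨huc, W, hW, hWu⟩, hfe⟩ := exists_decomposition_of_mem_classCH hf hy
  have h1 := tendsto_nhds_unique hl (tendsto_left_of_eqOn hy huc hfe)
  have h2 := tendsto_nhds_unique hr (tendsto_right_of_eqOn hy huc hfe)
  have h3 := eq_of_eqOn hy hfe
  have hu := ((hWu.tendsto_at (mem_of_mem_nhds hW)).comp (tendsto_add_atTop_nat 1)).sub_const
    (u (Real.cos θ))
  have h := hu.add (((tendsto_lagrangeOp_jumpFun_sub hθ 0).const_mul a).add
    ((tendsto_lagrangeOp_jumpFun_sub hθ 1).const_mul b))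
  simp only [sub_self, mul_zero, add_zero] at h
  refine h.congr fun N => ?_
  rw [lagrangeOp_congr hfe, lagrangeOp_add, lagrangeOp_add, lagrangeOp_smul, lagrangeOp_smul,
    h3, h1, h2]
  simp only [Function.comp_apply]
  split_ifs <;> ring

/-! ### Densities -/

/-- The lower density of `K` is at least `c`. -/
def LowerDensityGE (K : Set ℕ) (c : ℝ) : Prop :=
  ∀ η > 0, ∀ᶠ n : ℕ in atTop, c - η ≤ ((K ∩ Set.Icc 1 n).ncard : ℝ) / n

lemma ncard_inter_div_nonneg (K : Set ℕ) (n : ℕ) :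
    0 ≤ ((K ∩ Set.Icc 1 n).ncard : ℝ) / n := by positivity

lemma ncard_inter_Icc_le (K : Set ℕ) (n : ℕ) : (K ∩ Set.Icc 1 n).ncard ≤ n := by
  refine (Set.ncard_le_ncard inter_subset_right (Set.finite_Icc 1 n)).trans ?_
  rw [← Finset.coe_Icc, Set.ncard_coe_finset, Nat.card_Icc]
  omega

lemma ncard_inter_div_le_one (K : Set ℕ) (n : ℕ) :
    ((K ∩ Set.Icc 1 n).ncard : ℝ) / n ≤ 1 :=
  div_le_one_of_le₀ (by exact_mod_cast ncard_inter_Icc_le K n) n.cast_nonneg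

lemma isBoundedUnder_ncard (K : Set ℕ) :
    IsBoundedUnder (· ≤ ·) atTop fun n : ℕ => ((K ∩ Set.Icc 1 n).ncard : ℝ) / n :=
  isBoundedUnder_of ⟨1, ncard_inter_div_le_one K⟩

lemma isBoundedUnder_ge_ncard (K : Set ℕ) :
    IsBoundedUnder (· ≥ ·) atTop fun n : ℕ => ((K ∩ Set.Icc 1 n).ncard : ℝ) / n :=
  isBoundedUnder_of ⟨0, ncard_inter_div_nonneg K⟩

lemma LowerDensityGE.le_upperDensity {K : Set ℕ} {c : ℝ} (h : LowerDensityGE K c) :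
    c ≤ upperDensity K := by
  refine le_of_forall_sub_le fun η hη => ?_
  exact le_limsup_of_frequently_le (h η hη).frequently (isBoundedUnder_ncard K)

lemma ncard_add_ncard_compl (K : Set ℕ) (n : ℕ) :
    (K ∩ Set.Icc 1 n).ncard + (Kᶜ ∩ Set.Icc 1 n).ncard = n := by
  have h := Set.ncard_inter_add_ncard_sdiff_eq_ncard (Set.Icc 1 n) K (Set.finite_Icc 1 n)
  rw [← Finset.coe_Icc, Set.ncard_coe_finset, Nat.card_Icc] at h
  rw [← Finset.coe_Icc, inter_comm K, inter_comm Kᶜ, ← sdiff_eq]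
  omega

lemma LowerDensityGE.upperDensity_le {K : Set ℕ} {c : ℝ} (h : LowerDensityGE Kᶜ c) :
    upperDensity K ≤ 1 - c := by
  refine le_of_forall_pos_le_add fun η hη => ?_
  refine limsup_le_of_le (isBoundedUnder_ge_ncard K).isCoboundedUnder_le ?_
  filter_upwards [h η hη, eventually_gt_atTop 0] with n hn hn0
  have hn' : (0 : ℝ) < n := by exact_mod_cast hn0
  have h1 : ((K ∩ Set.Icc 1 n).ncard : ℝ) + (Kᶜ ∩ Set.Icc 1 n).ncard = n := by
    exact_mod_cast ncard_add_ncard_compl K n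
  have h2 : ((K ∩ Set.Icc 1 n).ncard : ℝ) / n + ((Kᶜ ∩ Set.Icc 1 n).ncard : ℝ) / n = 1 := by
    rw [← add_div, h1, div_self hn'.ne']
  linarith

/-- Lower densities are insensitive to finitely many exceptions. -/
lemma LowerDensityGE.mono {K L : Set ℕ} {c : ℝ} (h : LowerDensityGE K c)
    (hKL : ∀ᶠ n in atTop, n ∈ K → n ∈ L) : LowerDensityGE L c := by
  obtain ⟨n₀, hn₀⟩ := eventually_atTop.1 hKL
  intro η hη
  have hlim : Tendsto (fun n : ℕ => (n₀ : ℝ) / n) atTop (𝓝 0) :=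
    tendsto_const_div_atTop_nhds_zero_nat (n₀ : ℝ)
  filter_upwards [h (η / 2) (half_pos hη), hlim.eventually (gt_mem_nhds (half_pos hη))]
    with n hn hn2
  have hsub : K ∩ Set.Icc 1 n ⊆ (L ∩ Set.Icc 1 n) ∪ (Finset.range n₀ : Set ℕ) := by
    rintro k ⟨hk, hkn⟩
    by_cases hkn₀ : k < n₀
    · exact Or.inr (by simpa using hkn₀)
    · exact Or.inl ⟨hn₀ k (not_lt.1 hkn₀) hk, hkn⟩
  have hle : (K ∩ Set.Icc 1 n).ncard ≤ (L ∩ Set.Icc 1 n).ncard + n₀ := by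
    refine (Set.ncard_le_ncard hsub
      (((Set.finite_Icc 1 n).inter_of_right L).union (Finset.finite_toSet _))).trans ?_
    refine (Set.ncard_union_le _ _).trans ?_
    rw [Set.ncard_coe_finset, Finset.card_range]
  have hle' : ((K ∩ Set.Icc 1 n).ncard : ℝ) / n ≤
      ((L ∩ Set.Icc 1 n).ncard : ℝ) / n + n₀ / n := by
    rw [← add_div]
    gcongr
    exact_mod_cast hle
  linarith

lemma LowerDensityGE.union {K L : Set ℕ} {c d : ℝ} (hK : LowerDensityGE K c)
    (hL : LowerDensityGE L d) (hd : Disjoint K L) : LowerDensityGE (K ∪ L) (c + d) := by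
  intro η hη
  filter_upwards [hK (η / 2) (half_pos hη), hL (η / 2) (half_pos hη)] with n h1 h2
  rw [union_inter_distrib_right, Set.ncard_union_eq
    (hd.mono inter_subset_left inter_subset_left)
    ((Set.finite_Icc 1 n).inter_of_right K) ((Set.finite_Icc 1 n).inter_of_right L)]
  push_cast
  rw [add_div]
  linarith

lemma lowerDensityGE_zero (K : Set ℕ) : LowerDensityGE K 0 := by
  intro η hη
  refine Eventually.of_forall fun n => ?_
  linarith [ncard_inter_div_nonneg K n]

lemma lowerDensityGE_residue {p q m : ℕ} (hq : 0 < q) (hpq : Nat.Coprime p q) (hm : m < q) :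
    LowerDensityGE {n | ((n - 1) * p) % q = m} (1 / q) := by
  have hq' : (0 : ℝ) < q := by exact_mod_cast hq
  -- a solution of the congruence `v * p ≡ m`
  obtain ⟨v, hv, hvm⟩ : ∃ v < q, (v * p) % q = m := by
    obtain ⟨x, hxq, hx⟩ := Nat.exists_mul_mod_eq_of_coprime m hpq hq.ne'
    exact ⟨x, hxq, by rw [mul_comm, hx, Nat.mod_eq_of_lt hm]⟩
  intro η hη
  have hlim : Tendsto (fun n : ℕ => (1 : ℝ) / n) atTop (𝓝 0) :=
    tendsto_const_div_atTop_nhds_zero_nat 1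
  filter_upwards [hlim.eventually (gt_mem_nhds hη), eventually_gt_atTop 0] with n hn hn0
  have hn' : (0 : ℝ) < n := by exact_mod_cast hn0
  have hcard : n / q ≤ ({n | ((n - 1) * p) % q = m} ∩ Set.Icc 1 n).ncard := by
    have himg : ((Finset.range (n / q)).image fun j => v + 1 + j * q : Finset ℕ).card = n / q := by
      rw [Finset.card_image_of_injective, Finset.card_range]
      intro a b hab
      simp only at hab
      exact Nat.eq_of_mul_eq_mul_right hq (by omega)
    rw [← himg, ← Set.ncard_coe_finset]
    refine Set.ncard_le_ncard ?_ ((Set.finite_Icc 1 n).inter_of_right _)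
    intro k hk
    simp only [Finset.coe_image, Finset.coe_range, mem_image, mem_Iio] at hk
    obtain ⟨j, hj, rfl⟩ := hk
    have h1 : (j + 1) * q ≤ n := (Nat.mul_le_mul_right q hj).trans (Nat.div_mul_le_self n q)
    rw [add_mul, one_mul] at h1
    refine ⟨?_, by omega, by omega⟩
    rw [mem_ofPred_eq, show v + 1 + j * q - 1 = v + q * j by rw [mul_comm q]; omega, add_mul,
      mul_assoc, Nat.add_mul_mod_self_left, hvm]
  have h2 : (n : ℝ) / q - 1 ≤ (n / q : ℕ) := by
    have := Nat.lt_floor_add_one ((n : ℝ) / q)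
    rw [Nat.floor_div_eq_div] at this
    linarith
  have h3 : ((n / q : ℕ) : ℝ) ≤ ({n | ((n - 1) * p) % q = m} ∩ Set.Icc 1 n).ncard := by
    exact_mod_cast hcard
  have h4 : ((n : ℝ) / q - 1) / n = 1 / q - 1 / n := by field_simp
  have h5 : ((n : ℝ) / q - 1) / n ≤
      (({n | ((n - 1) * p) % q = m} ∩ Set.Icc 1 n).ncard : ℝ) / n := by
    gcongr
    linarith
  linarith

lemma lowerDensityGE_residues {p q : ℕ} (hq : 0 < q) (hpq : Nat.Coprime p q) (T : Finset ℕ)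
    (hT : ∀ m ∈ T, m < q) : LowerDensityGE {n | ((n - 1) * p) % q ∈ T} (T.card / q) := by
  induction T using Finset.induction_on with
  | empty => simpa using lowerDensityGE_zero _
  | insert m T hmT ih =>
    have h1 := lowerDensityGE_residue hq hpq (hT m (Finset.mem_insert_self m T))
    have h2 := ih fun k hk => hT k (Finset.mem_insert_of_mem hk)
    have hd : Disjoint {n | ((n - 1) * p) % q = m} {n | ((n - 1) * p) % q ∈ T} := by
      rw [Set.disjoint_left]
      rintro n hn hn'
      rw [mem_ofPred_eq] at hn hn'
      exact hmT (hn ▸ hn')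
    have h := h1.union h2 hd
    rw [Finset.card_insert_of_notMem hmT]
    push_cast
    rw [add_comm (T.card : ℝ), add_div]
    refine h.mono (Eventually.of_forall fun n hn => ?_)
    rw [mem_ofPred_eq, Finset.mem_insert]
    exact hn

lemma one_sub_iSup_eq {B : {ε : ℝ // 0 < ε} → Set ℕ} {c : ℝ}
    (h1 : ∀ ε, ∀ η > 0, LowerDensityGE (B ε)ᶜ (c - η))
    (h2 : ∀ η > 0, ∃ ε, LowerDensityGE (B ε) (1 - c - η)) :
    1 - ⨆ ε, upperDensity (B ε) = c := by
  have : Nonempty {ε : ℝ // 0 < ε} := ⟨⟨1, one_pos⟩⟩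
  have h : ⨆ ε, upperDensity (B ε) = 1 - c := by
    refine ciSup_eq_of_forall_le_of_forall_lt_exists_gt (fun ε => ?_) fun w hw => ?_
    · refine le_of_forall_pos_le_add fun η hη => ?_
      linarith [(h1 ε η hη).upperDensity_le]
    · obtain ⟨ε, hε⟩ := h2 ((1 - c - w) / 2) (by linarith)
      exact ⟨ε, by linarith [hε.le_upperDensity]⟩
  rw [h]
  ring

/-- The index of convergence of a sequence which is asymptotic to `s ((n - 1) p mod q)`. -/
lemma convIndex_eq_of_residues {p q : ℕ} (hq : 0 < q) (hpq : Nat.Coprime p q) {y : ℕ → ℝ}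
    {s : ℕ → ℝ} (hy : Tendsto (fun n => y n - s (((n - 1) * p) % q)) atTop (𝓝 0)) (L : ℝ)
    (G : Finset ℕ) (hG : ∀ m, m ∈ G ↔ m < q ∧ s m = L) :
    convIndex y L = G.card / q := by
  have hq' : (0 : ℝ) < q := by exact_mod_cast hq
  have hGq : G ⊆ Finset.range q := fun m hm => Finset.mem_range.2 ((hG m).1 hm).1
  have habs := hy.abs
  rw [abs_zero] at habs
  refine one_sub_iSup_eq (fun ε η hη => ?_) fun η hη => ?_
  · have h := lowerDensityGE_residues hq hpq G fun m hm => ((hG m).1 hm).1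
    have h' : LowerDensityGE {n | ((n - 1) * p) % q ∈ G} (G.card / q - η) := by
      intro η' hη'
      filter_upwards [h η' hη'] with n hn
      linarith
    refine h'.mono ?_
    filter_upwards [habs.eventually (gt_mem_nhds ε.2)] with n hn hnG
    replace hnG := (hG _).1 hnG
    rw [hnG.2, abs_lt] at hn
    rw [mem_compl_iff, mem_ofPred_eq, not_not]
    constructor <;> linarith
  · obtain ⟨ρ, hρ, hρs⟩ : ∃ ρ > 0, ∀ m ∈ Finset.range q \ G, ρ ≤ |s m - L| := by
      rcases (Finset.range q \ G).eq_empty_or_nonempty with h0 | h0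
      · exact ⟨1, one_pos, by simp [h0]⟩
      · obtain ⟨m, hm, hmin⟩ := Finset.exists_min_image _ (fun m => |s m - L|) h0
        refine ⟨|s m - L|, abs_pos.2 fun h => ?_, hmin⟩
        rw [Finset.mem_sdiff, Finset.mem_range] at hm
        exact hm.2 ((hG m).2 ⟨hm.1, by linarith⟩)
    refine ⟨⟨ρ / 2, by positivity⟩, ?_⟩
    have h := lowerDensityGE_residues hq hpq (Finset.range q \ G) fun m hm =>
      Finset.mem_range.1 (Finset.mem_sdiff.1 hm).1
    rw [Finset.card_sdiff_of_subset hGq, Finset.card_range,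
      Nat.cast_sub (by simpa using Finset.card_le_card hGq), sub_div, div_self hq'.ne'] at h
    have h' : LowerDensityGE {n | ((n - 1) * p) % q ∈ Finset.range q \ G}
        (1 - G.card / q - η) := by
      intro η' hη'
      filter_upwards [h η' hη'] with n hn
      linarith
    refine h'.mono ?_
    filter_upwards [habs.eventually (gt_mem_nhds (half_pos hρ))] with n hn hnG
    have h1 := hρs _ hnG
    rintro ⟨h2, h3⟩
    have h4 : |y n - L| < ρ / 2 := by rw [abs_lt]; constructor <;> linarith
    have h5 := abs_sub_le (s (((n - 1) * p) % q)) (y n) L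
    rw [abs_sub_comm _ (y n)] at h5
    linarith

/-! ### Equidistribution of the multiples of an irrational number -/

/-- The averages of a continuous function on the circle along the multiples of an irrational number
converge to its integral: this holds for the characters, hence for all continuous functions by
density. -/
lemma tendsto_average_circle {α : ℝ} (hα : Irrational α) (F : C(UnitAddCircle, ℂ)) :
    Tendsto (fun n : ℕ => (∑ k ∈ Finset.range n, F ((k * α : ℝ) : UnitAddCircle)) / n) atTop
      (𝓝 (∫ x, F x ∂AddCircle.haarAddCircle)) := by
  have hint : ∀ F : C(UnitAddCircle, ℂ), Integrable F AddCircle.haarAddCircle := fun F =>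
    F.continuous.integrable_of_hasCompactSupport (HasCompactSupport.of_compactSpace _)
  set S : Submodule ℂ C(UnitAddCircle, ℂ) :=
    { carrier := {F | Tendsto
        (fun n : ℕ => (∑ k ∈ Finset.range n, F ((k * α : ℝ) : UnitAddCircle)) / n) atTop
          (𝓝 (∫ x, F x ∂AddCircle.haarAddCircle))}
      add_mem' := by
        intro F G hF hG
        rw [mem_ofPred_eq] at *
        simp only [ContinuousMap.add_apply]
        rw [integral_add (hint F) (hint G)]
        refine (hF.add hG).congr fun n => ?_
        rw [Finset.sum_add_distrib, add_div]
      zero_mem' := by simp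
      smul_mem' := by
        intro c F hF
        rw [mem_ofPred_eq] at *
        simp only [ContinuousMap.smul_apply, smul_eq_mul]
        rw [integral_const_mul]
        refine (hF.const_mul c).congr fun n => ?_
        rw [mul_div_assoc', Finset.mul_sum] } with hS
  have hfour : ∀ k : ℤ, (fourier k : C(UnitAddCircle, ℂ)) ∈ S := by
    intro k
    change Tendsto _ _ _
    have hI : ∫ x : UnitAddCircle, fourier k x ∂AddCircle.haarAddCircle
        = if k = 0 then 1 else 0 := by
      have h := congrFun (fourierCoeff_fourier (T := 1) k) 0
      rw [fourierCoeff] at h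
      simp only [neg_zero, fourier_zero, one_smul] at h
      rw [h, Pi.single_apply]
      simp [eq_comm]
    rw [hI]
    split_ifs with hk
    · subst hk
      refine tendsto_const_nhds.congr' ?_
      filter_upwards [eventually_gt_atTop 0] with n hn
      simp only [fourier_zero, Finset.sum_const, Finset.card_range, nsmul_eq_mul, mul_one]
      rw [div_self (by exact_mod_cast hn.ne')]
    · set z : ℂ := fourier k ((α : ℝ) : UnitAddCircle) with hz
      have hpow : ∀ j : ℕ, fourier k ((j * α : ℝ) : UnitAddCircle) = z ^ j := by
        intro j
        rw [hz, fourier_coe_apply, fourier_coe_apply, ← Complex.exp_nat_mul]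
        congr 1
        push_cast
        ring
      have hz1 : z ≠ 1 := by
        rw [hz, fourier_coe_apply]
        intro h
        obtain ⟨m, hm⟩ := Complex.exp_eq_one_iff.1 h
        have h2 : (2 * Real.pi * Complex.I : ℂ) ≠ 0 := Complex.two_pi_I_ne_zero
        have h3 : (k * α : ℂ) = m := by
          apply mul_left_cancel₀ h2
          rw [mul_comm _ (m : ℂ), ← hm]
          push_cast
          ring
        have h4 : (k * α : ℝ) = m := by exact_mod_cast h3
        exact (hα.intCast_mul hk).ne_int m h4
      have hnorm : ‖z‖ = 1 := by
        rw [hz, fourier_apply]; exact Circle.norm_coe _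
      simp only [hpow]
      rw [tendsto_zero_iff_norm_tendsto_zero]
      refine squeeze_zero (fun n => norm_nonneg _) (fun n => ?_)
        (tendsto_const_div_atTop_nhds_zero_nat (2 / ‖z - 1‖))
      rw [geom_sum_eq hz1, norm_div, norm_div, Complex.norm_natCast]
      gcongr
      calc ‖z ^ n - 1‖ ≤ ‖z ^ n‖ + ‖(1 : ℂ)‖ := norm_sub_le _ _
        _ = 2 := by rw [norm_pow, hnorm]; norm_num
  have hclosed : ∀ F, F ∈ S.topologicalClosure → F ∈ S := by
    intro F hF
    rw [← SetLike.mem_coe, Submodule.topologicalClosure_coe, Metric.mem_closure_iff] at hF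
    change Tendsto _ _ _
    rw [Metric.tendsto_atTop]
    intro ε hε
    obtain ⟨G, hG, hFG⟩ := hF (ε / 4) (by positivity)
    have hG' : Tendsto _ _ _ := hG
    obtain ⟨n₀, hn₀⟩ := Metric.tendsto_atTop.1 hG' (ε / 4) (by positivity)
    refine ⟨n₀ + 1, fun n hn => ?_⟩
    have hn' : (0 : ℝ) < n := by exact_mod_cast (show 0 < n by omega)
    have hpt : ∀ x, ‖F x - G x‖ ≤ ε / 4 := fun x => by
      rw [← dist_eq_norm]; exact (ContinuousMap.dist_apply_le_dist x).trans hFG.le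
    have h1 : dist ((∑ k ∈ Finset.range n, F ((k * α : ℝ) : UnitAddCircle)) / n)
        ((∑ k ∈ Finset.range n, G ((k * α : ℝ) : UnitAddCircle)) / n) ≤ ε / 4 := by
      rw [dist_eq_norm, ← sub_div, ← Finset.sum_sub_distrib, norm_div, Complex.norm_natCast,
        div_le_iff₀ hn']
      refine (norm_sum_le_of_le _ fun k _ => hpt _).trans ?_
      simp [mul_comm]
    have h2 : dist (∫ x, G x ∂(AddCircle.haarAddCircle (T := 1)))
        (∫ x, F x ∂AddCircle.haarAddCircle) ≤ ε / 4 := by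
      rw [dist_comm, dist_eq_norm, ← integral_sub (hint F) (hint G)]
      refine (norm_integral_le_of_norm_le_const (Eventually.of_forall hpt)).trans ?_
      simp
    have h3 := hn₀ n (by omega)
    have h4 := dist_triangle4 ((∑ k ∈ Finset.range n, F ((k * α : ℝ) : UnitAddCircle)) / n)
      ((∑ k ∈ Finset.range n, G ((k * α : ℝ) : UnitAddCircle)) / n)
      (∫ x, G x ∂(AddCircle.haarAddCircle (T := 1))) (∫ x, F x ∂AddCircle.haarAddCircle)
    linarith
  have htop : (⊤ : Submodule ℂ C(UnitAddCircle, ℂ)) ≤ S.topologicalClosure := by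
    rw [← span_fourier_closure_eq_top (T := 1)]
    refine Submodule.topologicalClosure_mono (Submodule.span_le.2 ?_)
    rintro _ ⟨k, rfl⟩
    exact hfour k
  exact hclosed F (htop trivial)

lemma tendsto_average_fract {α : ℝ} (hα : Irrational α) {φ : ℝ → ℝ} (hφ : Continuous φ)
    (h01 : φ 0 = φ 1) :
    Tendsto (fun n : ℕ => (∑ k ∈ Finset.range n, φ (Int.fract (k * α))) / n) atTop
      (𝓝 (∫ x in (0 : ℝ)..1, φ x)) := by
  set F : C(UnitAddCircle, ℂ) := ⟨AddCircle.liftIco 1 0 fun x => (φ x : ℂ),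
    AddCircle.liftIco_zero_continuous (by rw [h01])
      (Complex.continuous_ofReal.comp hφ).continuousOn⟩ with hF
  have hFx : ∀ x : ℝ, F (x : UnitAddCircle) = φ (Int.fract x) := by
    intro x
    rw [← AddCircle.coe_fract x]
    exact AddCircle.liftIco_zero_coe_apply (f := fun x => (φ x : ℂ))
      ⟨Int.fract_nonneg x, Int.fract_lt_one x⟩
  have h := tendsto_average_circle hα F
  have hI : ∫ x, F x ∂AddCircle.haarAddCircle = ((∫ x in (0 : ℝ)..1, φ x : ℝ) : ℂ) := by
    rw [AddCircle.integral_haarAddCircle, inv_one, one_smul,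
      ← UnitAddCircle.intervalIntegral_preimage 0, zero_add, ← intervalIntegral.integral_ofReal]
    refine intervalIntegral.integral_congr_ae ?_
    have : ∀ᵐ x : ℝ, x ≠ 1 := by simp [ae_iff]
    filter_upwards [this] with x hx1 hx
    rw [uIoc_of_le zero_le_one] at hx
    rw [hFx, Int.fract_eq_self.2 ⟨hx.1.le, lt_of_le_of_ne hx.2 hx1⟩]
  rw [hI] at h
  have h' := (Complex.continuous_re.tendsto _).comp h
  rw [Complex.ofReal_re] at h'
  refine h'.congr fun n => ?_
  simp only [Function.comp_apply, hFx]
  rw [← Complex.ofReal_re (_ / _)]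
  congr 1
  push_cast
  rfl

/-- Open subsets of `]0, 1[` are visited by the fractional parts of the multiples of an irrational
number with lower density at least their measure. -/
lemma lowerDensityGE_fract {α : ℝ} (hα : Irrational α) {U : Set ℝ} (hU : IsOpen U)
    (hU01 : U ⊆ Ioo 0 1) :
    LowerDensityGE {n | Int.fract (((n - 1 : ℕ) : ℝ) * α) ∈ U} (volume.real U) := by
  have hUfin : volume U ≠ ⊤ := measure_ne_top_of_subset hU01 (by simp)
  intro η hη
  obtain ⟨K, hKU, hK, hKη⟩ : ∃ K ⊆ U, IsCompact K ∧ volume.real U - η / 2 ≤ volume.real K := by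
    rcases eq_or_ne (volume U) 0 with h0 | h0
    · refine ⟨∅, empty_subset _, isCompact_empty, ?_⟩
      rw [measureReal_def, h0]
      simp
      positivity
    · obtain ⟨K, hKU, hK, hlt⟩ := hU.exists_lt_isCompact (μ := volume)
        (ENNReal.sub_lt_self hUfin h0 (ENNReal.ofReal_pos.2 (half_pos hη)).ne')
      refine ⟨K, hKU, hK, ?_⟩
      have h1 := ENNReal.toReal_mono (measure_ne_top_of_subset hKU hUfin) hlt.le
      have h2 := ENNReal.le_toReal_sub (a := volume U) (b := ENNReal.ofReal (η / 2))
        ENNReal.ofReal_ne_top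
      rw [ENNReal.toReal_ofReal (by positivity)] at h2
      exact h2.trans h1
  obtain ⟨φ, hφ0, hφ1, hφ⟩ := exists_continuous_zero_one_of_isCompact' hK hU.isClosed_compl
    (disjoint_compl_right_iff_subset.2 hKU)
  have h0 : φ 0 = 0 := hφ0 fun h => lt_irrefl _ (hU01 h).1
  have h1 : φ 1 = 0 := hφ0 fun h => lt_irrefl _ (hU01 h).2
  have hlim := tendsto_average_fract hα φ.continuous (h0.trans h1.symm)
  have hint : volume.real K ≤ ∫ x in (0 : ℝ)..1, φ x := by
    rw [intervalIntegral.integral_of_le zero_le_one, ← integral_indicator_one hK.measurableSet]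
    have hsub : K ⊆ Ioc 0 1 := (hKU.trans hU01).trans Ioo_subset_Ioc_self
    rw [← integral_indicator measurableSet_Ioc]
    refine integral_mono_of_nonneg (Eventually.of_forall fun x => ?_) ?_
      (Eventually.of_forall fun x => ?_)
    · exact indicator_nonneg (fun _ _ => zero_le_one) x
    · exact (integrable_indicator_iff measurableSet_Ioc).2
        (φ.continuous.integrableOn_Icc.mono_set Ioc_subset_Icc_self)
    · by_cases hx : x ∈ K
      · rw [indicator_of_mem hx, indicator_of_mem (hsub hx), hφ1 hx]
      · rw [indicator_of_notMem hx]
        exact indicator_nonneg (fun _ _ => (hφ _).1) x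
  filter_upwards [hlim.eventually (lt_mem_nhds
    (show volume.real U - η < ∫ x in (0 : ℝ)..1, φ x by linarith))] with n hn
  refine hn.le.trans ?_
  gcongr
  classical
  have hle : ∀ k, φ (Int.fract (k * α)) ≤ if Int.fract (k * α) ∈ U then 1 else 0 := by
    intro k
    split_ifs with h
    · exact (hφ _).2
    · exact (hφ0 h).le
  refine (Finset.sum_le_sum fun (k : ℕ) _ => hle k).trans ?_
  rw [Finset.sum_boole]
  norm_cast
  have himg : (((Finset.range n).filter fun k : ℕ => Int.fract ((k : ℝ) * α) ∈ U).image
      (· + 1)).card = ((Finset.range n).filter fun k : ℕ => Int.fract ((k : ℝ) * α) ∈ U).card :=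
    Finset.card_image_of_injective _ (add_left_injective 1)
  rw [← himg, ← Set.ncard_coe_finset]
  refine Set.ncard_le_ncard ?_ ((Set.finite_Icc 1 n).inter_of_right _)
  intro k hk
  simp only [Finset.coe_image, Finset.coe_filter, Finset.mem_range, mem_image, mem_ofPred_eq] at hk
  obtain ⟨j, ⟨hj, hjU⟩, rfl⟩ := hk
  exact ⟨by simpa using hjU, by omega, by omega⟩

/-! ### Peano–Jordan content -/

lemma isElementary_empty : IsElementary ∅ := ⟨∅, by simp⟩

lemma IsElementary.union {E F : Set ℝ} (hE : IsElementary E) (hF : IsElementary F) :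
    IsElementary (E ∪ F) := by
  classical
  obtain ⟨s, rfl⟩ := hE
  obtain ⟨t, rfl⟩ := hF
  exact ⟨s ∪ t, (Finset.set_biUnion_union s t _).symm⟩

lemma IsElementary.isCompact {E : Set ℝ} (hE : IsElementary E) : IsCompact E := by
  obtain ⟨s, rfl⟩ := hE
  exact s.isCompact_biUnion fun p _ => isCompact_Icc

/-- Between a compact set and an open neighbourhood of it there is an elementary set. -/
lemma exists_isElementary_between {K U : Set ℝ} (hK : IsCompact K) (hU : IsOpen U) (hKU : K ⊆ U) :
    ∃ E, IsElementary E ∧ K ⊆ E ∧ E ⊆ U := by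
  refine hK.induction_on (p := fun s => ∃ E, IsElementary E ∧ s ⊆ E ∧ E ⊆ U)
    ⟨∅, isElementary_empty, subset_rfl, empty_subset _⟩ ?_ ?_ ?_
  · rintro s t hst ⟨E, hE, htE, hEU⟩
    exact ⟨E, hE, hst.trans htE, hEU⟩
  · rintro s t ⟨E, hE, hsE, hEU⟩ ⟨F, hF, htF, hFU⟩
    exact ⟨E ∪ F, hE.union hF, union_subset_union hsE htF, union_subset hEU hFU⟩
  · intro x hx
    obtain ⟨δ, hδ, hball⟩ := Metric.nhds_basis_closedBall.mem_iff.1 (hU.mem_nhds (hKU hx))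
    refine ⟨_, mem_nhdsWithin_of_mem_nhds (Metric.closedBall_mem_nhds x hδ), Metric.closedBall x δ,
      ⟨{(x - δ, x + δ)}, ?_⟩, subset_rfl, hball⟩
    simp [Real.closedBall_eq_Icc]

/-- An elementary set differs from its interior by finitely many endpoints only. -/
lemma IsElementary.volume_le_interior {E A : Set ℝ} (hE : IsElementary E) (hEA : E ⊆ A) :
    volume E ≤ volume (interior A) := by
  obtain ⟨s, rfl⟩ := hE
  have hsub : (⋃ p ∈ s, Icc p.1 p.2 : Set ℝ) ⊆
      interior A ∪ (⋃ p ∈ s, {p.1, p.2} : Set ℝ) := by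
    intro z hz
    obtain ⟨p, hp, hzp⟩ := mem_iUnion₂.1 hz
    by_cases h1 : z = p.1
    · exact Or.inr (mem_iUnion₂.2 ⟨p, hp, Or.inl h1⟩)
    by_cases h2 : z = p.2
    · exact Or.inr (mem_iUnion₂.2 ⟨p, hp, Or.inr h2⟩)
    refine Or.inl (mem_interior.2 ⟨Ioo p.1 p.2, ?_, isOpen_Ioo,
      lt_of_le_of_ne hzp.1 (Ne.symm h1), lt_of_le_of_ne hzp.2 h2⟩)
    exact Ioo_subset_Icc_self.trans ((subset_biUnion_of_mem (u := fun p : ℝ × ℝ => Icc p.1 p.2)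
      hp).trans hEA)
  have hfin : (⋃ p ∈ s, {p.1, p.2} : Set ℝ).Finite :=
    s.finite_toSet.biUnion fun p _ => toFinite _
  calc _ ≤ volume (interior A ∪ (⋃ p ∈ s, {p.1, p.2} : Set ℝ)) := measure_mono hsub
    _ ≤ volume (interior A) + volume (⋃ p ∈ s, {p.1, p.2} : Set ℝ) := measure_union_le _ _
    _ = volume (interior A) := by rw [hfin.measure_zero, add_zero]

lemma jordanOuter_eq {A : Set ℝ} (hA : Bornology.IsBounded A) :
    jordanOuter A = volume.real (closure A) := by
  have hc : IsCompact (closure A) := hA.isCompact_closure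
  unfold jordanOuter
  refine csInf_eq_of_forall_ge_of_forall_gt_exists_lt ?_ ?_ ?_
  · obtain ⟨E, hE, hAE, -⟩ := exists_isElementary_between hc isOpen_univ (subset_univ _)
    exact ⟨_, E, hE, subset_closure.trans hAE, rfl⟩
  · rintro _ ⟨E, hE, hAE, rfl⟩
    exact measureReal_mono (closure_minimal hAE hE.isCompact.isClosed) hE.isCompact.measure_ne_top
  · intro w hw
    obtain ⟨U, hU, hUo, hUw⟩ := (closure A).exists_isOpen_lt_of_lt (μ := volume)
      (ENNReal.ofReal w) ((ENNReal.lt_ofReal_iff_toReal_lt hc.measure_ne_top).2 hw)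
    obtain ⟨E, hE, hAE, hEU⟩ := exists_isElementary_between hc hUo hU
    refine ⟨_, ⟨E, hE, subset_closure.trans hAE, rfl⟩, ?_⟩
    exact (ENNReal.lt_ofReal_iff_toReal_lt hE.isCompact.measure_ne_top).1
      ((measure_mono hEU).trans_lt hUw)

lemma volume_interior_ne_top {A : Set ℝ} (hA : Bornology.IsBounded A) :
    volume (interior A) ≠ ⊤ :=
  measure_ne_top_of_subset (interior_subset.trans subset_closure)
    hA.isCompact_closure.measure_ne_top

lemma jordanInner_eq {A : Set ℝ} (hA : Bornology.IsBounded A) :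
    jordanInner A = volume.real (interior A) := by
  have hfin := volume_interior_ne_top hA
  unfold jordanInner
  refine csSup_eq_of_forall_le_of_forall_lt_exists_gt ?_ ?_ ?_
  · exact ⟨_, ∅, isElementary_empty, empty_subset _, rfl⟩
  · rintro _ ⟨E, hE, hEA, rfl⟩
    exact ENNReal.toReal_mono hfin (hE.volume_le_interior hEA)
  · intro w hw
    rcases lt_or_ge w 0 with hw0 | hw0
    · exact ⟨_, ⟨∅, isElementary_empty, empty_subset _, rfl⟩, by simpa using hw0⟩
    obtain ⟨K, hKA, hK, hwK⟩ := isOpen_interior.exists_lt_isCompact (μ := volume)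
      ((ENNReal.ofReal_lt_iff_lt_toReal hw0 hfin).2 hw)
    obtain ⟨E, hE, hKE, hEA⟩ := exists_isElementary_between hK isOpen_interior hKA
    refine ⟨_, ⟨E, hE, hEA.trans interior_subset, rfl⟩, ?_⟩
    exact (ENNReal.ofReal_lt_iff_lt_toReal hw0 hE.isCompact.measure_ne_top).1
      (hwK.trans_le (measure_mono hKE))

lemma volume_real_interior_add_frontier {A : Set ℝ} (hA : Bornology.IsBounded A) :
    volume.real (interior A) + volume.real (frontier A) = volume.real (closure A) := by
  rw [closure_eq_interior_union_frontier, measureReal_union disjoint_interior_frontier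
    isClosed_frontier.measurableSet (volume_interior_ne_top hA)
    (measure_ne_top_of_subset frontier_subset_closure hA.isCompact_closure.measure_ne_top)]

/-- A bounded set is Peano–Jordan measurable if and only if its boundary is a null set. -/
lemma isJordanMeasurable_iff {A : Set ℝ} :
    IsJordanMeasurable A ↔ Bornology.IsBounded A ∧ volume (frontier A) = 0 := by
  refine and_congr_right fun hA => ?_
  have hfin : volume (frontier A) ≠ ⊤ :=
    measure_ne_top_of_subset frontier_subset_closure hA.isCompact_closure.measure_ne_top
  rw [jordanInner_eq hA, jordanOuter_eq hA, ← volume_real_interior_add_frontier hA,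
    left_eq_add, measureReal_eq_zero_iff hfin]

/-! ### The indices of convergence at a jump -/

section
variable {l r : ℝ}

lemma volume_affine_preimage {Z : Set ℝ} (hZ : volume Z = 0) (hlr : l ≠ r) :
    volume {t | t ∈ Ioo (0 : ℝ) 1 ∧ l + (r - l) * gFun t ∈ Z} = 0 := by
  have h1 : volume ((fun z => (r - l) * z) ⁻¹' ((fun z => l + z) ⁻¹' Z)) = 0 := by
    rw [Real.volume_preimage_mul_left (sub_ne_zero.2 hlr.symm), measure_preimage_add, hZ, mul_zero]
  exact volume_gFun_preimage_eq_zero h1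

lemma continuousOn_affine_gFun (l r : ℝ) :
    ContinuousOn (fun t => l + (r - l) * gFun t) (Ioo 0 1) :=
  continuousOn_const.add (continuousOn_const.mul continuousOn_gFun)

lemma frontier_preimage_subset {ψ : ℝ → ℝ} (hψ : ContinuousOn ψ (Ioo 0 1)) (A : Set ℝ) :
    frontier {t | t ∈ Ioo (0 : ℝ) 1 ∧ ψ t ∈ A} ⊆
      {0, 1} ∪ {t | t ∈ Ioo (0 : ℝ) 1 ∧ ψ t ∈ frontier A} := by
  intro t ht
  have htc : t ∈ Icc (0 : ℝ) 1 := by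
    have := closure_mono (fun s (hs : s ∈ Ioo (0 : ℝ) 1 ∧ ψ s ∈ A) => hs.1) ht.1
    rwa [closure_Ioo zero_ne_one] at this
  rcases eq_or_ne t 0 with h0 | h0
  · exact Or.inl (Or.inl h0)
  rcases eq_or_ne t 1 with h1 | h1
  · exact Or.inl (Or.inr h1)
  have htI : t ∈ Ioo (0 : ℝ) 1 := ⟨lt_of_le_of_ne htc.1 h0.symm, lt_of_le_of_ne htc.2 h1⟩
  have hI : Ioo (0 : ℝ) 1 ∈ 𝓝 t := isOpen_Ioo.mem_nhds htI
  have hct := hψ.continuousAt hI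
  refine Or.inr ⟨htI, ?_, fun hint => ht.2 ?_⟩
  · rw [mem_closure_iff_frequently]
    exact hct.tendsto.frequently
      ((mem_closure_iff_frequently.1 ht.1).mono fun s (hs : s ∈ Ioo (0 : ℝ) 1 ∧ ψ s ∈ A) => hs.2)
  · rw [mem_interior_iff_mem_nhds] at hint ⊢
    exact inter_mem hI (hct.preimage_mem_nhds hint)

lemma isBounded_preimage (ψ : ℝ → ℝ) (A : Set ℝ) :
    Bornology.IsBounded {t | t ∈ Ioo (0 : ℝ) 1 ∧ ψ t ∈ A} :=
  (Metric.isBounded_Ioo 0 1).subset fun _ ht => ht.1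

lemma isJordanMeasurable_preimage (hlr : l ≠ r) {A : Set ℝ} (hA : IsJordanMeasurable A) :
    IsJordanMeasurable {t | t ∈ Ioo (0 : ℝ) 1 ∧ l + (r - l) * gFun t ∈ A} := by
  rw [isJordanMeasurable_iff] at hA ⊢
  refine ⟨isBounded_preimage _ A, ?_⟩
  refine measure_mono_null (frontier_preimage_subset (continuousOn_affine_gFun l r) A) ?_
  exact measure_union_null ((toFinite _).measure_zero _) (volume_affine_preimage hA.2 hlr)

/-- A sequence asymptotic to `g_i` along the fractional parts of the multiples of an irrational
number: the index of convergence to `A` is the content of the preimage of `A`. The interior of the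
preimage bounds it from below; from above, the closed neighbourhoods of `A` shrink to the closure
of `A`, whose preimage has the same measure. -/
lemma convIndexSet_eq_of_irrational (hlr : l ≠ r) {α : ℝ} (hα : Irrational α) {y : ℕ → ℝ} {d : ℝ}
    (hy : Tendsto (fun n => y n - (if Int.fract (((n - 1 : ℕ) : ℝ) * α) = 0 then d
      else l + (r - l) * gFun (Int.fract (((n - 1 : ℕ) : ℝ) * α)))) atTop (𝓝 0))
    {A : Set ℝ} (hA : IsJordanMeasurable A) :
    convIndexSet y A = jordanOuter {t | t ∈ Ioo (0 : ℝ) 1 ∧ l + (r - l) * gFun t ∈ A} := by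
  set ψ : ℝ → ℝ := fun t => l + (r - l) * gFun t with hψ
  have hψc : ContinuousOn ψ (Ioo 0 1) := continuousOn_affine_gFun l r
  set B := {t | t ∈ Ioo (0 : ℝ) 1 ∧ ψ t ∈ A} with hB
  have hBJ : IsJordanMeasurable B := isJordanMeasurable_preimage hlr hA
  have hBb : Bornology.IsBounded B := hBJ.1
  have hBint : jordanOuter B = volume.real (interior B) := by
    rw [← hBJ.2, jordanInner_eq hBb]
  have habs := hy.abs
  rw [abs_zero] at habs
  have hev : ∀ ε > 0, ∀ᶠ n : ℕ in atTop, Int.fract (((n - 1 : ℕ) : ℝ) * α) ∈ Ioo (0 : ℝ) 1 →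
      |y n - ψ (Int.fract (((n - 1 : ℕ) : ℝ) * α))| < ε := by
    intro ε hε
    filter_upwards [habs.eventually (gt_mem_nhds hε)] with n hn hn0
    rwa [if_neg hn0.1.ne'] at hn
  rw [hBint]
  refine one_sub_iSup_eq (fun ε η hη => ?_) fun η hη => ?_
  · have h := lowerDensityGE_fract hα isOpen_interior
      (interior_subset.trans fun t (ht : t ∈ B) => ht.1)
    have h' : LowerDensityGE {n | Int.fract (((n - 1 : ℕ) : ℝ) * α) ∈ interior B}
        (volume.real (interior B) - η) := by
      intro η' hη'
      filter_upwards [h η' hη'] with n hn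
      linarith
    refine h'.mono ?_
    filter_upwards [hev ε ε.2] with n hn hnB
    have hmem : Int.fract (((n - 1 : ℕ) : ℝ) * α) ∈ B := interior_subset hnB
    have hlt := abs_lt.1 (hn hmem.1)
    rw [mem_compl_iff, mem_ofPred_eq, not_not]
    exact ⟨_, hmem.2, _, hlt, by ring⟩
  · set V : ℕ → Set ℝ := fun k => Ioo 0 1 ∩ ψ ⁻¹' (Metric.cthickening (1 / ((k : ℝ) + 1)) A)ᶜ
      with hV
    have hVo : ∀ k, IsOpen (V k) := fun k =>
      hψc.isOpen_inter_preimage isOpen_Ioo Metric.isClosed_cthickening.isOpen_compl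
    have hVmono : Monotone V := by
      intro j k hjk
      refine inter_subset_inter_right _ (preimage_mono (compl_subset_compl.2 ?_))
      exact Metric.cthickening_mono (by gcongr) A
    have hcover : Ioo (0 : ℝ) 1 ⊆
        (⋃ k, V k) ∪ (closure B ∪ {t | t ∈ Ioo (0 : ℝ) 1 ∧ ψ t ∈ frontier A}) := by
      intro t ht
      by_cases h1 : ψ t ∈ closure A
      · right
        by_cases h2 : ψ t ∈ A
        · exact Or.inl (subset_closure ⟨ht, h2⟩)
        · exact Or.inr ⟨ht, h1, fun h => h2 (interior_subset h)⟩
      · left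
        rw [Metric.closure_eq_iInter_cthickening] at h1
        simp only [mem_iInter, not_forall] at h1
        obtain ⟨δ, hδ, hnot⟩ := h1
        obtain ⟨k, hk⟩ := exists_nat_one_div_lt hδ
        exact mem_iUnion.2 ⟨k, ht, fun h => hnot (Metric.cthickening_mono hk.le A h)⟩
    have hVfin : volume (⋃ k, V k) ≠ ⊤ :=
      measure_ne_top_of_subset (iUnion_subset fun k => inter_subset_left)
        (by simp : volume (Ioo (0 : ℝ) 1) ≠ ⊤)
    have hVtot : 1 - volume.real (interior B) ≤ volume.real (⋃ k, V k) := by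
      have h1 := measure_mono (μ := volume) hcover
      have h2 : volume (closure B ∪ {t | t ∈ Ioo (0 : ℝ) 1 ∧ ψ t ∈ frontier A})
          ≤ volume (closure B) := by
        refine (measure_union_le _ _).trans ?_
        rw [volume_affine_preimage (isJordanMeasurable_iff.1 hA).2 hlr, add_zero]
      have h3 := (h1.trans (measure_union_le _ _)).trans (add_le_add_right h2 _)
      have hcfin : volume (closure B) ≠ ⊤ := hBb.isCompact_closure.measure_ne_top
      have h4 := ENNReal.toReal_mono (ENNReal.add_ne_top.2 ⟨hVfin, hcfin⟩) h3
      rw [ENNReal.toReal_add hVfin hcfin, Real.volume_Ioo] at h4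
      simp only [sub_zero, ENNReal.ofReal_one, ENNReal.toReal_one] at h4
      have h5 : volume.real (closure B) = volume.real (interior B) := by
        rw [← jordanOuter_eq hBb, hBint]
      rw [← h5]
      simp only [measureReal_def]
      linarith
    have hlim : Tendsto (fun k => volume.real (V k)) atTop (𝓝 (volume.real (⋃ k, V k))) :=
      (ENNReal.tendsto_toReal hVfin).comp (tendsto_measure_iUnion_atTop hVmono)
    obtain ⟨k, hk⟩ := (hlim.eventually (lt_mem_nhds
      (show 1 - volume.real (interior B) - η < volume.real (⋃ k, V k) by linarith))).exists
    have hpos : (0 : ℝ) < 1 / ((k : ℝ) + 1) := by positivity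
    refine ⟨⟨1 / ((k : ℝ) + 1) / 2, half_pos hpos⟩, ?_⟩
    have h := lowerDensityGE_fract hα (hVo k) inter_subset_left
    have h' : LowerDensityGE {n | Int.fract (((n - 1 : ℕ) : ℝ) * α) ∈ V k}
        (1 - volume.real (interior B) - η) := by
      intro η' hη'
      filter_upwards [h η' hη'] with n hn
      linarith
    refine h'.mono ?_
    filter_upwards [hev _ (half_pos hpos)] with n hn hnV
    have hlt := hn hnV.1
    rintro ⟨a, ha, e, he, hae⟩
    refine hnV.2 (Metric.thickening_subset_cthickening _ _ ?_)
    rw [Metric.mem_thickening_iff]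
    refine ⟨a, ha, ?_⟩
    have he' : |e| < 1 / ((k : ℝ) + 1) / 2 := abs_lt.2 he
    have hae' : a + e = y n := hae
    rw [Real.dist_eq, show ψ (Int.fract (((n - 1 : ℕ) : ℝ) * α)) - a
      = e - (y n - ψ (Int.fract (((n - 1 : ℕ) : ℝ) * α))) by rw [← hae']; ring]
    exact (abs_sub _ _).trans_lt (by linarith)

end

theorem mainTheorem4
    (f : ℝ → ℝ) (hf : f ∈ classCH)
    -- `x 0, …, x (N - 1)` are the distinct discontinuity points of `f` on `[-1, 1]`
    (N : ℕ) (x : Fin N → ℝ) (hxinj : Function.Injective x)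
    (hxI : ∀ i, x i ∈ Set.Ioo (-1 : ℝ) 1)
    (hdisc : ∀ y ∈ Set.Icc (-1 : ℝ) 1,
      ¬ ContinuousWithinAt f (Set.Icc (-1) 1) y ↔ ∃ i, x i = y)
    -- `l i = f(x i - 0)` and `r i = f(x i + 0)` are the finite one-sided limits
    (l r : Fin N → ℝ)
    (hl : ∀ i, Tendsto f (𝓝[<] x i) (𝓝 (l i)))
    (hr : ∀ i, Tendsto f (𝓝[>] x i) (𝓝 (r i)))
    -- `x i = cos (θ i)`
    (θ : Fin N → ℝ) (hθI : ∀ i, θ i ∈ Set.Ioo 0 Real.pi)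
    (hθ : ∀ i, x i = Real.cos (θ i))
    -- `g i = f(x i - 0) + (f(x i + 0) - f(x i - 0)) g`
    (g : Fin N → ℝ → ℝ) (hg : ∀ i t, g i t = l i + (r i - l i) * gFun t) :
    (∀ K : Set ℝ, IsCompact K → K ⊆ Set.Ioo (-1) 1 \ Set.range x →
      TendstoUniformlyOn (fun n : ℕ => lagrangeOp n f) f atTop K) ∧
    (∀ i, l i ≠ r i →
      (∀ p q : ℕ, q ≠ 0 → Nat.gcd p q = 1 → θ i / Real.pi = (p : ℝ) / (q : ℝ) →
        ((∀ m ∈ Set.Icc 1 (q - 1), g i ((m : ℝ) / (q : ℝ)) ≠ f (x i)) →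
          convIndex (fun n => lagrangeOp n f (x i)) (f (x i)) = 1 / (q : ℝ) ∧
          ∀ m ∈ Set.Icc 1 (q - 1),
            convIndex (fun n => lagrangeOp n f (x i)) (g i ((m : ℝ) / (q : ℝ))) = 1 / (q : ℝ)) ∧
        (∀ m₀ ∈ Set.Icc 1 (q - 1), g i ((m₀ : ℝ) / (q : ℝ)) = f (x i) →
          convIndex (fun n => lagrangeOp n f (x i)) (f (x i)) = 2 / (q : ℝ) ∧
          ∀ m ∈ Set.Icc 1 (q - 1), m ≠ m₀ →
            convIndex (fun n => lagrangeOp n f (x i)) (g i ((m : ℝ) / (q : ℝ))) = 1 / (q : ℝ))) ∧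
      (Irrational (θ i / Real.pi) →
        ∀ A : Set ℝ, IsJordanMeasurable A →
          IsJordanMeasurable {t | t ∈ Set.Ioo (0 : ℝ) 1 ∧ g i t ∈ A} ∧
          convIndexSet (fun n => lagrangeOp n f (x i)) A =
            jordanOuter {t | t ∈ Set.Ioo (0 : ℝ) 1 ∧ g i t ∈ A})) := by
  refine ⟨fun K hK hKx => ?_, fun i hlr => ?_⟩
  · refine tendstoUniformlyOn_of_mem_classCH hf hK (hKx.trans sdiff_subset) fun y hy => ?_
    obtain ⟨hyI, hyx⟩ := hKx hy
    have hc : ContinuousWithinAt f (Set.Icc (-1) 1) y := by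
      by_contra h
      exact hyx ((hdisc y (Ioo_subset_Icc_self hyI)).1 h)
    exact hc.continuousAt (Icc_mem_nhds hyI.1 hyI.2)
  have hmain := tendsto_lagrangeOp_sub hf (hθI i) (hθ i ▸ hl i) (hθ i ▸ hr i)
  rw [← hθ i] at hmain
  have hmain' : Tendsto (fun n : ℕ => lagrangeOp n f (x i) -
      (if Int.fract (((n - 1 : ℕ) : ℝ) * (θ i / Real.pi)) = 0 then f (x i)
        else l i + (r i - l i) * gFun (Int.fract (((n - 1 : ℕ) : ℝ) * (θ i / Real.pi)))))
      atTop (𝓝 0) := by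
    rw [← tendsto_add_atTop_iff_nat 1]
    simpa only [Nat.add_sub_cancel, mul_div_assoc] using hmain
  refine ⟨fun p q hq hpq hα => ?_, fun hα A hA => ?_⟩
  · have hq0 : 0 < q := Nat.pos_of_ne_zero hq
    have hq' : (0 : ℝ) < q := by exact_mod_cast hq0
    set s : ℕ → ℝ := fun m => if m = 0 then f (x i) else g i ((m : ℝ) / q) with hs
    have hs0 : s 0 = f (x i) := by simp [hs]
    have hsm : ∀ m, m ≠ 0 → s m = g i ((m : ℝ) / q) := fun m hm => by simp [hs, hm]
    have hy : Tendsto (fun n : ℕ => lagrangeOp n f (x i) - s (((n - 1) * p) % q)) atTop (𝓝 0) := by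
      refine hmain'.congr fun n => ?_
      have hfr : Int.fract (((n - 1 : ℕ) : ℝ) * (θ i / Real.pi))
          = ((((n - 1) * p) % q : ℕ) : ℝ) / q := by
        rw [hα, ← Int.fract_div_natCast_eq_div_natCast_mod]
        push_cast
        rw [mul_div_assoc]
      rw [hfr, hs]
      simp only [hg, div_eq_zero_iff, hq'.ne', or_false, Nat.cast_eq_zero]
    have hfrac : ∀ m ∈ Set.Icc 1 (q - 1), ((m : ℝ) / q) ∈ Ioo (0 : ℝ) 1 := by
      intro m hm
      have h1 : (0 : ℝ) < m := by exact_mod_cast hm.1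
      have h2 : (m : ℝ) < q := by
        have := hm.2
        exact_mod_cast (show m < q by omega)
      exact ⟨by positivity, by rwa [div_lt_one hq']⟩
    -- the values `g i (m / q)` are pairwise distinct
    have hinj : ∀ m ∈ Set.Icc 1 (q - 1), ∀ k ∈ Set.Icc 1 (q - 1),
        g i ((m : ℝ) / q) = g i ((k : ℝ) / q) → m = k := by
      intro m hm k hk h
      rw [hg, hg] at h
      have h1 := mul_left_cancel₀ (sub_ne_zero.2 hlr.symm) (add_left_cancel h)
      have h2 := strictAntiOn_gFun.injOn (hfrac m hm) (hfrac k hk) h1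
      rw [div_left_inj' hq'.ne'] at h2
      exact_mod_cast h2
    -- the index of convergence to a value different from `f (x i)`
    have hval : ∀ m ∈ Set.Icc 1 (q - 1), g i ((m : ℝ) / q) ≠ f (x i) →
        convIndex (fun n => lagrangeOp n f (x i)) (g i ((m : ℝ) / q)) = 1 / (q : ℝ) := by
      intro m hm hne
      rw [convIndex_eq_of_residues hq0 hpq hy _ {m} fun k => ?_]
      · simp
      · rw [Finset.mem_singleton]
        constructor
        · rintro rfl
          have := hm.1
          have := hm.2
          exact ⟨by omega, hsm k (by omega)⟩
        · rintro ⟨hk, hsk⟩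
          rcases eq_or_ne k 0 with rfl | hk0
          · rw [hs0] at hsk
            exact absurd hsk.symm hne
          · rw [hsm k hk0] at hsk
            exact hinj k ⟨by omega, by omega⟩ m hm hsk
    refine ⟨fun hne => ⟨?_, fun m hm => hval m hm (hne m hm)⟩, fun m₀ hm₀ heq => ⟨?_, ?_⟩⟩
    · rw [convIndex_eq_of_residues hq0 hpq hy _ {0} fun k => ?_]
      · simp
      · rw [Finset.mem_singleton]
        constructor
        · rintro rfl
          exact ⟨hq0, hs0⟩
        · rintro ⟨hk, hsk⟩
          by_contra hk0
          rw [hsm k hk0] at hsk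
          exact hne k ⟨by omega, by omega⟩ hsk
    · have h0 : (0 : ℕ) ≠ m₀ := by have := hm₀.1; omega
      rw [convIndex_eq_of_residues hq0 hpq hy _ {0, m₀} fun k => ?_]
      · rw [Finset.card_pair h0]
        norm_num
      · rw [Finset.mem_insert, Finset.mem_singleton]
        constructor
        · rintro (rfl | rfl)
          · exact ⟨hq0, hs0⟩
          · have := hm₀.1
            have := hm₀.2
            exact ⟨by omega, by rw [hsm k (by omega), heq]⟩
        · rintro ⟨hk, hsk⟩
          rcases eq_or_ne k 0 with hk0 | hk0
          · exact Or.inl hk0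
          · rw [hsm k hk0, ← heq] at hsk
            exact Or.inr (hinj k ⟨by omega, by omega⟩ m₀ hm₀ hsk)
    · intro m hm hmm
      exact hval m hm fun h => hmm (hinj m hm m₀ hm₀ (h.trans heq.symm))
  · have hgi : g i = fun t => l i + (r i - l i) * gFun t := funext (hg i)
    rw [hgi]
    exact ⟨isJordanMeasurable_preimage hlr hA, convIndexSet_eq_of_irrational hlr hα hmain' hA⟩
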